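/- A poset $(S,\le)$ contains a poset $(H,\le')$ if there is an injection $f\colon H\to S$ such that $u\le' v$ implies $f(u)\le f(v)$. A family $\mathcal F\subseteq 2^{[n]}$ is $H$-free if $(\mathcal F,\subseteq)$ does not contain $H$, and $\mathrm{La}(n,H)$ denotes the largest size of an $H$-free family of subsets of $[n]=\{1,\dots,n\}$. For $m\ge 2$ the crown $\mathcal O_{2m}$ is the poset of height $2$ that is a cycle of length $2m$ as an undirected graph: it has $2m$ distinct elements $a_i,b_i$ $(i\in\mathbb Z/m\mathbb Z)$, and its only strict relations are $a_i<b_i$ and $a_i<b_{i+1}$. **Theorem.** For every integer $k\ge 2$, as $n\to\infty$, $$\mathrm{La}(n,\mathcal O_{4k})=(1+o(1))\binom{n}{\lfloor n/2\rfloor} \qquad\text{and}\qquad \mathrm{La}(n,\mathcal O_{4k-2})\le\Bigl(1+\frac{\sqrt2}{2}+o(1)\Bigr)\binom{n}{\lfloor n/2\rfloor},$$ where, for each fixed $k$, the terms $o(1)$ are functions of $n$ that tend to $0$ as $n\to\infty$. -/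

import Mathlib

/-- The poset `S` contains the poset `H` (as a not necessarily induced subposet): there is an
order-preserving injection from `H` to `S`. -/
def ContainsPoset (S H : Type*) [PartialOrder S] [PartialOrder H] : Prop :=
  ∃ f : H → S, Function.Injective f ∧ ∀ u v : H, u ≤ v → f u ≤ f v

/-- A family `F` of subsets of an `n`-element set is `H`-free if the poset `(F, ⊆)` does not
contain `H` as a subposet. -/
def PosetFree (H : Type*) [PartialOrder H] {n : ℕ} (F : Finset (Finset (Fin n))) : Prop :=
  ¬ ContainsPoset {A : Finset (Fin n) // A ∈ F} H

open Classical in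
/-- `La n H` is the largest size of an `H`-free family of subsets of an `n`-element set. -/
noncomputable def La (n : ℕ) (H : Type*) [PartialOrder H] : ℕ :=
  (Finset.univ.filter (fun F : Finset (Finset (Fin n)) => PosetFree H F)).sup Finset.card

/-- The underlying set of the crown with `2 * m` elements: `m` elements on the bottom level and
`m` elements on the top level, both indexed cyclically. -/
inductive Crown (m : ℕ) : Type
  | bot (i : ZMod m) : Crown m
  | top (i : ZMod m) : Crown m

/-- The order of the crown: apart from equalities, the only relations are
`bot i ≤ top i` and `bot i ≤ top (i + 1)`. Thus, for `2 ≤ m`, the elements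
`top 0, bot 0, top 1, bot 1, …, top (m - 1), bot (m - 1)` form, in this cyclic order,
a cycle of length `2 * m`. -/
def Crown.Rel {m : ℕ} (x y : Crown m) : Prop :=
  x = y ∨ ∃ i : ZMod m, x = Crown.bot i ∧ (y = Crown.top i ∨ y = Crown.top (i + 1))

instance Crown.instPartialOrder (m : ℕ) : PartialOrder (Crown m) where
  le := Crown.Rel
  le_refl x := Or.inl rfl
  le_trans := by
    rintro x y z (rfl | ⟨i, rfl, hy⟩) hyz
    · exact hyz
    · rcases hyz with rfl | ⟨j, rfl, -⟩
      · exact Or.inr ⟨i, rfl, hy⟩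
      · rcases hy with hy | hy <;> cases hy
  le_antisymm := by
    rintro x y (rfl | ⟨i, rfl, hy⟩) hyx
    · rfl
    · rcases hyx with h | ⟨j, rfl, -⟩
      · exact h.symm
      · rcases hy with hy | hy <;> cases hy

/-! If a random maximal chain meets `F` in X sets, then X ≤ 1 + C(X,2). Taking expectations, the
Lubell weight of `F` is at most 1 plus the expected number of comparable pairs on the chain
(`lubell_le_one_add_pairDensity`). Sets outside the middle levels are negligible, so everything
rests on bounding pairs.

Pairs at distance at least two: `m` members below and `m` members above a common set already contain
the crown, so double counting through intermediate sets makes these pairs cost only O(1/n) of the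
weight (`sum_pairDensity_far_le`).

Consecutive levels: for a set S, join x and y when S ∪ {x, y} lies in Q. An m-cycle through points x
with S ∪ {x} in P is a crown, so on those points the graph has edge density at most about β. By the
minimum-degree form of Erdős–Stone, β is arbitrarily small for even `m` and close to 1/2 for odd
`m`. Cauchy–Schwarz and AM-GM then bound the pair density by γ/2 times the sum of the two level
densities, with γ slightly above √β (`pairDensity_succ_le`). With P = Q = F every set would be
charged twice. But a member with many lower and many upper covers in `F` gives a crown, so `F`
splits into P and F \ P such that only pairs going up from P to F \ P matter; each set is then
charged once (`lubell_le_of_posetFree`).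

Hence the Lubell weight is at most 1/(1 - γ/2 - o(1)). This is 1 + o(1) for even `m`; for odd `m`
the limiting value 1/(1 - √2/4) is below 1.55, so rough constants suffice for 1 + √2/2. The middle
layer gives the lower bound. -/

/-! ### Cycles in dense graphs -/

/-- `G` has a cycle of length `m` whose vertices lie in `V`. -/
def HasCycleIn {α : Type*} (G : SimpleGraph α) (V : Finset α) (m : ℕ) : Prop :=
  ∃ x : ℕ → α, (∀ i < m, x i ∈ V) ∧ Set.InjOn x (Set.Iio m) ∧
    (∀ i, i + 1 < m → G.Adj (x i) (x (i + 1))) ∧ G.Adj (x (m - 1)) (x 0)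

lemma HasCycleIn.mono {α : Type*} {G : SimpleGraph α} {V W : Finset α} {m : ℕ}
    (h : HasCycleIn G V m) (hVW : V ⊆ W) : HasCycleIn G W m := by
  obtain ⟨x, hx, h⟩ := h
  exact ⟨x, fun i hi => hVW (hx i hi), h⟩

lemma HasCycleIn.of_hom {α β : Type*} {G : SimpleGraph α} {H : SimpleGraph β} {V : Finset α}
    {W : Finset β} {m : ℕ} (f : β → α) (hf : Function.Injective f)
    (hW : ∀ b ∈ W, f b ∈ V) (hadj : ∀ a b, H.Adj a b → G.Adj (f a) (f b))
    (h : HasCycleIn H W m) : HasCycleIn G V m := by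
  obtain ⟨x, hx, hinj, hs, hc⟩ := h
  exact ⟨f ∘ x, fun i hi => hW _ (hx i hi), fun i hi j hj hij => hinj hi hj (hf hij),
    fun i hi => hadj _ _ (hs i hi), hadj _ _ hc⟩

lemma hasCycleIn_completeEquipartite_two {k : ℕ} (hk : 1 ≤ k) :
    HasCycleIn (SimpleGraph.completeEquipartiteGraph 2 (2 * k)) Finset.univ (2 * k) := by
  refine ⟨fun i => (⟨i % 2, by omega⟩, ⟨i % (2 * k), Nat.mod_lt _ (by omega)⟩), ?_, ?_, ?_, ?_⟩
  · intro i _; exact Finset.mem_univ _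
  · intro i hi j hj hij
    simp only [Prod.mk.injEq, Fin.mk.injEq] at hij
    have := hij.2
    rwa [Nat.mod_eq_of_lt hi, Nat.mod_eq_of_lt hj] at this
  · intro i hi
    simp only [SimpleGraph.completeEquipartiteGraph_adj, ne_eq, Fin.mk.injEq]
    omega
  · simp only [SimpleGraph.completeEquipartiteGraph_adj, ne_eq, Fin.mk.injEq]
    omega

lemma hasCycleIn_completeEquipartite_three {m : ℕ} (hm : 3 ≤ m) :
    HasCycleIn (SimpleGraph.completeEquipartiteGraph 3 m) Finset.univ m := by
  -- Colours alternate 0, 1; the last vertex takes the third colour, since for odd `m` it would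
  -- otherwise share colour 0 with its cyclic neighbour. The second coordinate keeps the vertices
  -- distinct.
  refine ⟨fun i => (⟨if i + 1 = m then 2 else i % 2, by split_ifs <;> omega⟩,
    ⟨i % m, Nat.mod_lt _ (by omega)⟩), ?_, ?_, ?_, ?_⟩
  · intro i _; exact Finset.mem_univ _
  · intro i hi j hj hij
    simp only [Prod.mk.injEq, Fin.mk.injEq] at hij
    have := hij.2
    rwa [Nat.mod_eq_of_lt hi, Nat.mod_eq_of_lt hj] at this
  · intro i hi
    simp only [SimpleGraph.completeEquipartiteGraph_adj, ne_eq, Fin.mk.injEq]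
    split_ifs <;> omega
  · simp only [SimpleGraph.completeEquipartiteGraph_adj, ne_eq, Fin.mk.injEq]
    rw [if_pos (by omega), if_neg (by omega)]
    norm_num

open Classical in
/-- A graph in which every vertex has large degree inside `V` contains a long cycle in `V`, as soon
as the corresponding complete equipartite graph does. -/
lemma exists_hasCycleIn_of_degree {m r t : ℕ} {ε : ℝ} (hε : 0 < ε)
    (hcyc : HasCycleIn (SimpleGraph.completeEquipartiteGraph (r + 1) t) Finset.univ m) :
    ∃ N : ℕ, ∀ {α : Type} (G : SimpleGraph α) (V : Finset α), N < V.card →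
      (∀ v ∈ V, (1 - 1 / r + ε) * V.card ≤ ((V.filter (G.Adj v)).card : ℝ)) →
      HasCycleIn G V m := by
  obtain ⟨N, hN⟩ := Filter.eventually_atTop.1
    (SimpleGraph.eventually_completeEquipartiteGraph_isContained_of_minDegree hε r t)
  refine ⟨N, fun {α} G V hV hdeg => ?_⟩
  set n := V.card with hn
  let e : Fin n ≃ V := V.equivFin.symm
  let f : Fin n → α := fun i => (e i : α)
  have hf : Function.Injective f := fun i j h => e.injective (Subtype.ext h)
  let H : SimpleGraph (Fin n) := G.comap f
  have hdegH : ∀ i, H.degree i = (V.filter (G.Adj (f i))).card := by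
    intro i
    rw [← SimpleGraph.card_neighborFinset_eq_degree, ← Finset.card_image_of_injective _ hf]
    congr 1
    ext a
    simp only [Finset.mem_image, SimpleGraph.mem_neighborFinset, Finset.mem_filter]
    constructor
    · rintro ⟨j, hj, rfl⟩
      exact ⟨(e j).2, hj⟩
    · rintro ⟨ha, hadj⟩
      refine ⟨e.symm ⟨a, ha⟩, ?_, by simp [f]⟩
      simpa [H, f] using hadj
  have : Nonempty (Fin n) := ⟨⟨0, by omega⟩⟩
  obtain ⟨g⟩ := hN n hV.le (G := H) (by
    obtain ⟨i, hi⟩ := H.exists_minimal_degree_vertex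
    rw [hi, hdegH]
    exact hdeg _ (e i).2)
  refine hcyc.of_hom (fun b => f (g b)) (hf.comp g.injective) (fun b _ => (e _).2) ?_
  intro a b hab
  exact g.toHom.map_adj hab

open Classical in
/-- Density bound for graphs without a cycle of length `m`, with ordered pairs of adjacent
vertices counted. -/
lemma exists_card_adj_le {m r t : ℕ} {ε : ℝ} (hε : 0 < ε) (hβ : (0 : ℝ) ≤ 1 - 1 / r + ε)
    (hcyc : HasCycleIn (SimpleGraph.completeEquipartiteGraph (r + 1) t) Finset.univ m) :
    ∃ K : ℝ, 0 ≤ K ∧ ∀ {α : Type} (G : SimpleGraph α) (V : Finset α), ¬ HasCycleIn G V m →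
      (∑ v ∈ V, ((V.filter (G.Adj v)).card : ℝ)) ≤
        V.card * ((1 - 1 / r + ε) * V.card + K) := by
  obtain ⟨N, hN⟩ := exists_hasCycleIn_of_degree hε hcyc
  set β : ℝ := 1 - 1 / r + ε
  -- `N` covers vertex sets too small for the degree criterion. Deleting a low-degree vertex from w
  -- + 1 vertices loses up to 2β(w + 1), while the quadratic term grows by β(2w + 1); the summand
  -- `β` is the difference.
  refine ⟨N + β, by positivity, fun {α} G V => ?_⟩
  induction V using Finset.strongInduction with
  | H V ih =>
    intro hV
    rcases le_or_gt V.card N with hle | hlt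
    · have h1 : (∑ v ∈ V, ((V.filter (G.Adj v)).card : ℝ)) ≤ ∑ v ∈ V, (N : ℝ) := by
        refine Finset.sum_le_sum fun v _ => ?_
        exact_mod_cast (Finset.card_filter_le _ _).trans hle
      rw [Finset.sum_const, nsmul_eq_mul] at h1
      refine h1.trans ?_
      gcongr
      have : 0 ≤ β * V.card := by positivity
      linarith
    · have : ∃ v ∈ V, ((V.filter (G.Adj v)).card : ℝ) < β * V.card := by
        by_contra! hcon
        exact hV (hN G V hlt hcon)
      obtain ⟨v, hv, hdv⟩ := this
      have ih' := ih (V.erase v) (Finset.erase_ssubset hv)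
        (fun h => hV (h.mono (Finset.erase_subset _ _)))
      have hW : V.card = (V.erase v).card + 1 := by
        rw [Finset.card_erase_of_mem hv]; have := Finset.card_pos.2 ⟨v, hv⟩; omega
      have hsplit : (∑ u ∈ V, ((V.filter (G.Adj u)).card : ℝ)) =
          (∑ u ∈ V.erase v, (((V.erase v).filter (G.Adj u)).card : ℝ))
            + 2 * (V.filter (G.Adj v)).card := by
        rw [← Finset.add_sum_erase _ _ hv]
        have : ∀ u ∈ V.erase v, ((V.filter (G.Adj u)).card : ℝ) =
            (((V.erase v).filter (G.Adj u)).card : ℝ) + if G.Adj v u then 1 else 0 := by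
          intro u _
          rw [← Finset.insert_erase hv, Finset.filter_insert, Finset.erase_insert (by simp)]
          by_cases h : G.Adj u v
          · rw [if_pos h, if_pos h.symm, Finset.card_insert_of_notMem (by simp)]
            push_cast; ring
          · rw [if_neg h, if_neg (fun h' => h h'.symm), add_zero]
        rw [Finset.sum_congr rfl this, Finset.sum_add_distrib, ← Finset.sum_filter]
        have h2 : (V.erase v).filter (G.Adj v) = V.filter (G.Adj v) := by
          rw [← Finset.insert_erase hv, Finset.filter_insert, Finset.erase_insert (by simp),
            if_neg (G.irrefl)]
        rw [h2]; simp; ring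
      rw [hsplit]
      rw [hW] at hdv ⊢
      push_cast at hdv ⊢
      set w : ℝ := ((V.erase v).card : ℝ)
      have hw : 0 ≤ w := Nat.cast_nonneg _
      have hNn : (0 : ℝ) ≤ N := Nat.cast_nonneg _
      nlinarith

/-! ### Crowns inside families of sets -/

lemma containsPoset_crown {S : Type*} [PartialOrder S] {m : ℕ} (hm : 2 ≤ m) (a b : ℕ → S)
    (ha : Set.InjOn a (Set.Iio m)) (hb : Set.InjOn b (Set.Iio m))
    (hab : ∀ i < m, ∀ j < m, a i ≠ b j) (h₀ : ∀ i < m, a i ≤ b i)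
    (h₁ : ∀ i, i + 1 < m → a i ≤ b (i + 1)) (h₂ : a (m - 1) ≤ b 0) :
    ContainsPoset S (Crown m) := by
  obtain ⟨m, rfl⟩ : ∃ l, m = l + 1 := ⟨m - 1, by omega⟩
  have hlt : ∀ i : ZMod (m + 1), i.val < m + 1 := fun i => i.val_lt
  refine ⟨fun c => Crown.casesOn c (fun i => a i.val) (fun i => b i.val), ?_, ?_⟩
  · rintro (i | i) (j | j) hij
    · exact congrArg _ (ZMod.val_injective _ (ha (hlt i) (hlt j) hij))
    · exact (hab _ (hlt i) _ (hlt j) hij).elim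
    · exact (hab _ (hlt j) _ (hlt i) hij.symm).elim
    · exact congrArg _ (ZMod.val_injective _ (hb (hlt i) (hlt j) hij))
  · rintro u v (rfl | ⟨i, rfl, rfl | rfl⟩)
    · exact le_rfl
    · exact h₀ _ (hlt i)
    · change a i.val ≤ b (i + 1).val
      rcases Nat.lt_or_ge (i.val + 1) (m + 1) with h | h
      · rw [ZMod.val_add_of_lt]
        · rw [ZMod.val_one'' (by omega)]; exact h₁ _ h
        · rw [ZMod.val_one'' (by omega)]; exact h
      · have hi : i.val = m := by have := hlt i; omega
        have : (i + 1).val = 0 := by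
          rw [ZMod.val_add, ZMod.val_one'' (by omega), hi, Nat.mod_self]
        rw [this, hi]
        exact h₂

/-- A complete bipartite comparability between two `m`-sets contains every height-two poset with `m`
elements on each side, in particular the crown. -/
lemma not_posetFree_of_complete {n m : ℕ} (hm : 2 ≤ m) {F : Finset (Finset (Fin n))}
    {P Q : Finset (Finset (Fin n))} (hP : P ⊆ F) (hQ : Q ⊆ F) (hPm : m ≤ P.card)
    (hQm : m ≤ Q.card) (h : ∀ A ∈ P, ∀ B ∈ Q, A ⊂ B) : ¬ PosetFree (Crown m) F := by
  obtain ⟨P', hP', hPc⟩ := Finset.exists_subset_card_eq hPm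
  obtain ⟨Q', hQ', hQc⟩ := Finset.exists_subset_card_eq hQm
  let e := P'.equivFinOfCardEq hPc
  let f := Q'.equivFinOfCardEq hQc
  have hpos : 0 < m := by omega
  let a : ℕ → {A // A ∈ F} := fun i =>
    ⟨e.symm ⟨i % m, Nat.mod_lt _ hpos⟩, hP (hP' (e.symm _).2)⟩
  let b : ℕ → {A // A ∈ F} := fun i =>
    ⟨f.symm ⟨i % m, Nat.mod_lt _ hpos⟩, hQ (hQ' (f.symm _).2)⟩
  have hab : ∀ i j, (a i).1 ⊂ (b j).1 := fun i j =>
    h _ (hP' (e.symm _).2) _ (hQ' (f.symm _).2)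
  refine not_not.2 (containsPoset_crown hm a b ?_ ?_ (fun i _ j _ hij => ?_)
    (fun i _ => (hab _ _).subset) (fun i _ => (hab _ _).subset) (hab _ _).subset)
  · intro i hi j hj hij
    have := e.symm.injective (Subtype.ext (congrArg (fun z : {A // A ∈ F} => z.1) hij))
    simpa [Nat.mod_eq_of_lt (Set.mem_Iio.1 hi), Nat.mod_eq_of_lt (Set.mem_Iio.1 hj)] using this
  · intro i hi j hj hij
    have := f.symm.injective (Subtype.ext (congrArg (fun z : {A // A ∈ F} => z.1) hij))
    simpa [Nat.mod_eq_of_lt (Set.mem_Iio.1 hi), Nat.mod_eq_of_lt (Set.mem_Iio.1 hj)] using this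
  · exact (hab i j).ne (congrArg _ hij)

/-- The graph on the ground set in which `x` and `y` are adjacent when adding both of them to `S`
gives a member of the family `Q`. -/
def linkGraph {n : ℕ} (Q : Finset (Finset (Fin n))) (S : Finset (Fin n)) :
    SimpleGraph (Fin n) where
  Adj x y := x ≠ y ∧ insert x (insert y S) ∈ Q
  symm := ⟨fun x y h => ⟨h.1.symm, by rw [Finset.insert_comm]; exact h.2⟩⟩
  loopless := ⟨fun x h => h.1 rfl⟩

/-- The vertices of the cycle, added to `S`, form the bottom of the crown and its edges form the
top; incidence in the cycle is containment. -/
lemma not_posetFree_of_hasCycleIn {n m : ℕ} (hm : 3 ≤ m) {F P Q : Finset (Finset (Fin n))}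
    (hP : P ⊆ F) (hQ : Q ⊆ F) {S V : Finset (Fin n)} (hVS : ∀ x ∈ V, x ∉ S)
    (hVP : ∀ x ∈ V, insert x S ∈ P) (h : HasCycleIn (linkGraph Q S) V m) :
    ¬ PosetFree (Crown m) F := by
  obtain ⟨x, hxV, hinj, hs, hc⟩ := h
  have hx : ∀ i < m, x i ∉ S := fun i hi => hVS _ (hxV i hi)
  -- Cyclic predecessor: top element i is the edge from x (i - 1) to x i, matching the crown
  -- relations `bot (i - 1)`, `bot i` ≤ `top i`.
  set p : ℕ → ℕ := fun i => if i = 0 then m - 1 else i - 1 with hp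
  have hpm : ∀ i < m, p i < m := by intro i hi; simp only [hp]; split_ifs <;> omega
  have hadj : ∀ i < m, (linkGraph Q S).Adj (x (p i)) (x i) := by
    intro i hi
    simp only [hp]
    split_ifs with h
    · subst h; exact hc
    · have := hs (i - 1) (by omega)
      rwa [Nat.sub_add_cancel (by omega)] at this
  let a : ℕ → {A // A ∈ F} := fun i =>
    if hi : i < m then ⟨insert (x i) S, hP (hVP _ (hxV i hi))⟩
    else ⟨insert (x 0) S, hP (hVP _ (hxV 0 (by omega)))⟩
  let b : ℕ → {A // A ∈ F} := fun i =>
    if hi : i < m then ⟨insert (x (p i)) (insert (x i) S), hQ (hadj i hi).2⟩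
    else ⟨insert (x 0) S, hP (hVP _ (hxV 0 (by omega)))⟩
  have ha : ∀ i < m, (a i).1 = insert (x i) S := fun i hi => by simp only [a, dif_pos hi]
  have hb : ∀ i < m, (b i).1 = insert (x (p i)) (insert (x i) S) := fun i hi => by
    simp only [b, dif_pos hi]
  have hmem : ∀ i < m, ∀ j < m, x i ∈ (b j).1 → i = p j ∨ i = j := by
    intro i hi j hj h
    rw [hb j hj, Finset.mem_insert, Finset.mem_insert] at h
    rcases h with h | h | h
    · exact Or.inl (hinj hi (hpm j hj) h)
    · exact Or.inr (hinj hi hj h)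
    · exact (hx i hi h).elim
  refine not_not.2 (containsPoset_crown (by omega) a b ?_ ?_ ?_ ?_ ?_ ?_)
  · intro i hi j hj hij
    have h1 : insert (x i) S = insert (x j) S := by
      rw [← ha i hi, ← ha j hj, hij]
    have : x i ∈ insert (x j) S := h1 ▸ Finset.mem_insert_self _ _
    rcases Finset.mem_insert.1 this with h | h
    · exact hinj hi hj h
    · exact (hx i hi h).elim
  · intro i hi j hj hij
    -- Equal tops mean that {p i, i} and {p j, j} agree; for m ≥ 3 the swap i = p j, j = p i is
    -- impossible, which leaves i = j.
    have h1 := hmem i hi j hj (by rw [← hij, hb i hi]; simp)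
    have h2 := hmem (p i) (hpm i hi) j hj (by rw [← hij, hb i hi]; simp)
    have h3 := hmem j hj i hi (by rw [hij, hb j hj]; simp)
    simp only [Set.mem_Iio] at hi hj
    simp only [hp] at h1 h2 h3
    split_ifs at h1 h2 h3 <;> omega
  · intro i hi j hj hij
    have h1 : (b j).1.card = (a i).1.card := by rw [hij]
    rw [hb j hj, ha i hi, Finset.card_insert_of_notMem, Finset.card_insert_of_notMem (hx j hj),
      Finset.card_insert_of_notMem (hx i hi)] at h1
    · omega
    · rw [Finset.mem_insert, not_or]
      exact ⟨(hadj j hj).1, hx _ (hpm j hj)⟩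
  · intro i hi
    change (a i).1 ⊆ (b i).1
    rw [ha i hi, hb i hi]
    exact Finset.subset_insert _ _
  · intro i hi
    change (a i).1 ⊆ (b (i + 1)).1
    rw [ha i (by omega), hb _ hi]
    exact Finset.insert_subset_insert _ (Finset.subset_insert _ _)
  · change (a (m - 1)).1 ⊆ (b 0).1
    rw [ha _ (by omega), hb _ (by omega)]
    exact Finset.insert_subset_insert _ (Finset.subset_insert _ _)

/-! ### Extremal families and the middle layer -/

lemma posetFree_mono {H : Type*} [PartialOrder H] {n : ℕ} {F F' : Finset (Finset (Fin n))}
    (h : PosetFree H F) (hF : F' ⊆ F) : PosetFree H F' := by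
  rintro ⟨f, hf, hle⟩
  exact h ⟨fun u => ⟨(f u).1, hF (f u).2⟩, fun u v huv =>
      hf (Subtype.ext (congrArg (fun z : {A // A ∈ F} => z.1) huv)),
    fun u v huv => hle u v huv⟩

lemma posetFree_layer (m n r : ℕ) :
    PosetFree (Crown m) (Finset.powersetCard r (Finset.univ : Finset (Fin n))) := by
  rintro ⟨f, hf, hle⟩
  have h : (Crown.bot 0 : Crown m) ≤ Crown.top 0 := Or.inr ⟨0, rfl, Or.inl rfl⟩
  have hsub : (f (Crown.bot 0)).1 ⊆ (f (Crown.top 0)).1 := hle _ _ h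
  have h1 := (Finset.mem_powersetCard.1 (f (Crown.bot 0)).2).2
  have h2 := (Finset.mem_powersetCard.1 (f (Crown.top 0)).2).2
  have := Finset.eq_of_subset_of_card_le hsub (by rw [h1, h2])
  cases hf (Subtype.ext this)

lemma choose_middle_le_La (m n : ℕ) : n.choose (n / 2) ≤ La n (Crown m) := by
  classical
  unfold La
  have := Finset.le_sup (f := Finset.card) (s := Finset.univ.filter
    (fun F : Finset (Finset (Fin n)) => PosetFree (Crown m) F))
    (Finset.mem_filter.2 ⟨Finset.mem_univ _, posetFree_layer m n (n / 2)⟩)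
  rw [Finset.card_powersetCard, Finset.card_univ, Fintype.card_fin] at this
  convert this

lemma exists_posetFree_card_eq_La (m n : ℕ) :
    ∃ F : Finset (Finset (Fin n)), PosetFree (Crown m) F ∧ F.card = La n (Crown m) := by
  classical
  have hne : (Finset.univ.filter
      (fun F : Finset (Finset (Fin n)) => PosetFree (Crown m) F)).Nonempty :=
    ⟨_, Finset.mem_filter.2 ⟨Finset.mem_univ _, posetFree_layer m n 0⟩⟩
  obtain ⟨F, hF, h⟩ := Finset.exists_mem_eq_sup _ hne Finset.card
  refine ⟨F, (Finset.mem_filter.1 hF).2, ?_⟩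
  unfold La
  rw [← h]

/-! ### The inequality X ≤ 1 + C(X,2) averaged over chains -/

section LubellInequality

variable {α : Type*} [DecidableEq α]

/-- The expected number of members of `F` strictly below `B` on a random maximal chain through
`B`. -/
noncomputable def lowerWeight (F : Finset (Finset α)) (B : Finset α) : ℝ :=
  ∑ A ∈ F.filter (· ⊂ B), 1 / (B.card.choose A.card : ℝ)

lemma lowerWeight_nonneg (F : Finset (Finset α)) (B : Finset α) : 0 ≤ lowerWeight F B :=
  Finset.sum_nonneg fun _ _ => by positivity

/-- A random maximal chain below `T` passes through a uniformly random `T.erase x`, and a proper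
subset `B` survives exactly for the x in T \ B. -/
lemma sum_ssubset_div_choose (F : Finset (Finset α)) (g : Finset α → ℝ) (T : Finset α) :
    ∑ B ∈ F.filter (· ⊂ T), g B / (T.card.choose B.card : ℝ) =
      (∑ x ∈ T, ∑ B ∈ F.filter (· ⊆ T.erase x), g B / ((T.erase x).card.choose B.card : ℝ))
        / T.card := by
  have hswap : ∑ x ∈ T, ∑ B ∈ F.filter (· ⊆ T.erase x),
      g B / ((T.erase x).card.choose B.card : ℝ) =
      ∑ B ∈ F.filter (· ⊂ T), ∑ x ∈ T \ B, g B / ((T.card - 1).choose B.card : ℝ) := by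
    rw [Finset.sum_comm' (t' := F.filter (· ⊂ T)) (s' := fun B => T \ B)]
    · refine Finset.sum_congr rfl fun B _ => Finset.sum_congr rfl fun x hx => ?_
      rw [Finset.card_erase_of_mem (Finset.mem_sdiff.1 hx).1]
    · intro x B
      simp only [Finset.mem_filter, Finset.mem_sdiff, Finset.subset_erase]
      constructor
      · rintro ⟨hx, hB, hBT, hxB⟩
        exact ⟨⟨hx, hxB⟩, hB, hBT, fun h => hxB (h hx)⟩
      · rintro ⟨⟨hx, hxB⟩, hB, hBT⟩
        exact ⟨hx, hB, hBT.1, hxB⟩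
  rw [hswap, Finset.sum_div]
  refine Finset.sum_congr rfl fun B hB => ?_
  have hBT : B ⊂ T := (Finset.mem_filter.1 hB).2
  have hlt := Finset.card_lt_card hBT
  obtain ⟨t, ht⟩ : ∃ t, T.card = t + 1 := ⟨T.card - 1, by omega⟩
  rw [Finset.sum_const, Finset.card_sdiff_of_subset hBT.1, nsmul_eq_mul, ht, Nat.add_sub_cancel]
  have h1 : (t.choose B.card : ℝ) * ((t + 1 : ℕ) : ℝ) =
      ((t + 1).choose B.card : ℝ) * ((t + 1 - B.card : ℕ) : ℝ) := by
    exact_mod_cast Nat.choose_mul_succ_eq t B.card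
  have h2 : (0 : ℝ) < t.choose B.card := by exact_mod_cast Nat.choose_pos (by omega)
  have h3 : (0 : ℝ) < (t + 1).choose B.card := by exact_mod_cast Nat.choose_pos (by omega)
  have h4 : (0 : ℝ) < ((t + 1 : ℕ) : ℝ) := by positivity
  field_simp
  linear_combination (g B) * h1

/-- Induction on the top of the chain. If `T` is not in `F`, average over the sets `T.erase x`. If
it is, the proper subsets contribute at most `lowerWeight F T`, which the term of `T` itself
subtracts. -/
lemma sum_one_sub_lowerWeight_le_one (F : Finset (Finset α)) (T : Finset α) :
    ∑ B ∈ F.filter (· ⊆ T), (1 - lowerWeight F B) / (T.card.choose B.card : ℝ) ≤ 1 := by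
  induction T using Finset.strongInduction with
  | H T ih =>
    by_cases hTF : T ∈ F
    · have hfil : F.filter (· ⊆ T) = insert T (F.filter (· ⊂ T)) := by
        ext B
        simp only [Finset.mem_filter, Finset.mem_insert, subset_iff_ssubset_or_eq]
        constructor
        · rintro ⟨h, h' | rfl⟩ <;> simp [*]
        · rintro (rfl | h) <;> simp [*]
      rw [hfil, Finset.sum_insert (by simp)]
      have h1 : ∑ B ∈ F.filter (· ⊂ T), (1 - lowerWeight F B) / (T.card.choose B.card : ℝ) ≤
          lowerWeight F T := by
        refine Finset.sum_le_sum fun B _ => ?_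
        gcongr
        linarith [lowerWeight_nonneg F B]
      simp only [Nat.choose_self, Nat.cast_one, div_one]
      linarith
    · have hfil : F.filter (· ⊆ T) = F.filter (· ⊂ T) := by
        refine Finset.filter_congr fun B hB => ?_
        rw [subset_iff_ssubset_or_eq]
        exact ⟨fun h => h.resolve_right (by rintro rfl; exact hTF hB), Or.inl⟩
      rw [hfil, sum_ssubset_div_choose]
      refine div_le_one_of_le₀ ((Finset.sum_le_sum fun x hx => ih _ (Finset.erase_ssubset hx)).trans
        ?_) (by positivity)
      simp

end LubellInequality

/-! ### Level densities and pair densities -/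

section Levels

variable {n : ℕ}

/-- The members of `F` of size `r`. -/
def level (F : Finset (Finset (Fin n))) (r : ℕ) : Finset (Finset (Fin n)) :=
  F.filter (fun A => A.card = r)

/-- The density of `F` on the level `r`. -/
noncomputable def density (F : Finset (Finset (Fin n))) (r : ℕ) : ℝ :=
  (level F r).card / (n.choose r : ℝ)

/-- The pairs `A ⊂ B` with `A ∈ P` of size `a` and `B ∈ Q` of size `b`. -/
def levelPairs (P Q : Finset (Finset (Fin n))) (a b : ℕ) :
    Finset (Finset (Fin n) × Finset (Fin n)) :=
  (level P a ×ˢ level Q b).filter (fun p => p.1 ⊂ p.2)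

/-- The probability that a random maximal chain meets `P` at level `a` and `Q` at level `b`. -/
noncomputable def pairDensity (P Q : Finset (Finset (Fin n))) (a b : ℕ) : ℝ :=
  (levelPairs P Q a b).card / ((n.choose b : ℝ) * b.choose a)

/-- The Lubell weight of a family. -/
noncomputable def lubell (F : Finset (Finset (Fin n))) : ℝ :=
  ∑ r ∈ Finset.range (n + 1), density F r

lemma mem_level {F : Finset (Finset (Fin n))} {r : ℕ} {A : Finset (Fin n)} :
    A ∈ level F r ↔ A ∈ F ∧ A.card = r := Finset.mem_filter

lemma mem_levelPairs {P Q : Finset (Finset (Fin n))} {a b : ℕ}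
    {p : Finset (Fin n) × Finset (Fin n)} :
    p ∈ levelPairs P Q a b ↔ (p.1 ∈ level P a ∧ p.2 ∈ level Q b) ∧ p.1 ⊂ p.2 := by
  simp [levelPairs, and_assoc]

lemma density_nonneg (F : Finset (Finset (Fin n))) (r : ℕ) : 0 ≤ density F r := by
  unfold density; positivity

lemma card_mem_range (A : Finset (Fin n)) : A.card ∈ Finset.range (n + 1) := by
  have := Finset.card_le_univ A
  rw [Fintype.card_fin] at this
  simpa [Nat.lt_succ_iff] using this

lemma sum_card_eq_sum_level (F : Finset (Finset (Fin n))) (g : Finset (Fin n) → ℝ) :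
    ∑ A ∈ F, g A = ∑ r ∈ Finset.range (n + 1), ∑ A ∈ level F r, g A :=
  (Finset.sum_fiberwise_of_maps_to (fun A _ => card_mem_range A) g).symm

lemma lubell_eq (F : Finset (Finset (Fin n))) :
    lubell F = ∑ A ∈ F, 1 / (n.choose A.card : ℝ) := by
  rw [sum_card_eq_sum_level, lubell]
  refine Finset.sum_congr rfl fun r _ => ?_
  rw [Finset.sum_congr rfl (g := fun _ => 1 / (n.choose r : ℝ))
    (fun A hA => by rw [(mem_level.1 hA).2])]
  rw [Finset.sum_const, nsmul_eq_mul, density, mul_one_div]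

lemma card_levelPairs_eq_sum_right (P Q : Finset (Finset (Fin n))) (a b : ℕ) :
    (levelPairs P Q a b).card = ∑ B ∈ level Q b, ((level P a).filter (· ⊂ B)).card := by
  rw [levelPairs, Finset.card_filter, Finset.sum_product_right]
  simp only [Finset.card_filter]

lemma card_levelPairs_eq_sum_left (P Q : Finset (Finset (Fin n))) (a b : ℕ) :
    (levelPairs P Q a b).card = ∑ A ∈ level P a, ((level Q b).filter (A ⊂ ·)).card := by
  rw [levelPairs, Finset.card_filter, Finset.sum_product]
  simp only [Finset.card_filter]

lemma lubell_le_one_add_pairDensity (F : Finset (Finset (Fin n))) :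
    lubell F ≤ 1 + ∑ b ∈ Finset.range (n + 1), ∑ a ∈ Finset.range (n + 1),
      pairDensity F F a b := by
  have h := sum_one_sub_lowerWeight_le_one F (Finset.univ : Finset (Fin n))
  simp only [Finset.subset_univ, Finset.filter_true, Finset.card_univ, Fintype.card_fin, sub_div,
    Finset.sum_sub_distrib] at h
  rw [← lubell_eq] at h
  have h2 : ∑ B ∈ F, lowerWeight F B / (n.choose B.card : ℝ) =
      ∑ b ∈ Finset.range (n + 1), ∑ a ∈ Finset.range (n + 1), pairDensity F F a b := by
    rw [sum_card_eq_sum_level]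
    refine Finset.sum_congr rfl fun b _ => ?_
    have : ∀ B ∈ level F b, lowerWeight F B / (n.choose B.card : ℝ) =
        ∑ a ∈ Finset.range (n + 1),
          (((level F a).filter (· ⊂ B)).card : ℝ) / ((n.choose b : ℝ) * b.choose a) := by
      intro B hB
      rw [(mem_level.1 hB).2, lowerWeight, sum_card_eq_sum_level, Finset.sum_div]
      refine Finset.sum_congr rfl fun a _ => ?_
      have hl : level (F.filter (· ⊂ B)) a = (level F a).filter (· ⊂ B) := by
        rw [level, level, Finset.filter_comm]
      rw [hl, (mem_level.1 hB).2, Finset.sum_congr rfl (g := fun _ => 1 / (b.choose a : ℝ))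
        (fun A hA => by rw [(mem_level.1 (Finset.mem_filter.1 hA).1).2]), Finset.sum_const,
        nsmul_eq_mul]
      rw [mul_one_div, div_div, mul_comm]
    rw [Finset.sum_congr rfl this, Finset.sum_comm]
    refine Finset.sum_congr rfl fun a _ => ?_
    rw [pairDensity, card_levelPairs_eq_sum_right, ← Finset.sum_div]
    push_cast
    rfl
  linarith

end Levels

/-! ### Comparable pairs at distance at least two -/

lemma le_choose_of_pos {x j : ℕ} (hj : 1 ≤ j) (hx : j + 1 ≤ x) : x ≤ x.choose j := by
  induction x generalizing j with
  | zero => omega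
  | succ x ih =>
    obtain ⟨j, rfl⟩ : ∃ i, j = i + 1 := ⟨j - 1, by omega⟩
    rw [Nat.choose_succ_succ']
    rcases Nat.lt_or_ge (j + 1) x with h | h
    · have h1 := ih (j := j + 1) (by omega) (by omega)
      have h2 : 0 < x.choose j := Nat.choose_pos (by omega)
      omega
    · obtain rfl : x = j + 1 := by omega
      simp [Nat.choose_succ_self_right]

lemma mul_pred_le_two_mul_choose {x j : ℕ} (hj : 2 ≤ j) (hx : j + 2 ≤ x) :
    x * (x - 1) ≤ 2 * x.choose j := by
  induction x generalizing j with
  | zero => omega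
  | succ x ih =>
    obtain ⟨j, rfl⟩ : ∃ i, j = i + 1 := ⟨j - 1, by omega⟩
    rcases Nat.lt_or_ge (j + 2) x with h | h
    · rw [Nat.choose_succ_succ']
      have h1 := ih (j := j + 1) (by omega) (by omega)
      have h2 : x ≤ x.choose j := le_choose_of_pos (by omega) (by omega)
      obtain ⟨y, rfl⟩ : ∃ y, x = y + 1 := ⟨x - 1, by omega⟩
      simp only [Nat.add_sub_cancel] at *
      nlinarith
    · obtain rfl : x = j + 2 := by omega
      rw [← Nat.choose_symm (by omega : j + 1 ≤ j + 2 + 1),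
        show j + 2 + 1 - (j + 1) = 2 by omega, Nat.choose_two_right]
      have := Nat.div_mul_cancel (Nat.even_mul_pred_self (j + 2 + 1)).two_dvd
      omega

section

variable {n : ℕ}

/-- Count triples A ⊆ U ⊆ B with U on level `u`. For fixed U either at most `m` sets A or at most
`m` sets B occur, since otherwise a crown appears; so their product is at most `m` times their sum.
-/
lemma card_levelPairs_mul_choose_le {m : ℕ} (hm : 2 ≤ m) {F : Finset (Finset (Fin n))}
    (hF : PosetFree (Crown m) F) {a u b : ℕ} (hau : a ≤ u) (hab : a < b) :
    (levelPairs F F a b).card * (b - a).choose (u - a) ≤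
      m * ((level F a).card * (n - a).choose (u - a) + (level F b).card * b.choose u) := by
  set L := Finset.powersetCard u (Finset.univ : Finset (Fin n))
  have h1 : (levelPairs F F a b).card * (b - a).choose (u - a) =
      ∑ U ∈ L, ((levelPairs F F a b).filter (fun p => p.1 ⊆ U ∧ U ⊆ p.2)).card := by
    have : ∀ p ∈ levelPairs F F a b,
        (L.filter (fun U => p.1 ⊆ U ∧ U ⊆ p.2)).card = (b - a).choose (u - a) := by
      intro p hp
      obtain ⟨⟨hA, hB⟩, hAB⟩ := mem_levelPairs.1 hp
      have hcard := Finset.card_filter_powersetCard_subset p.1 p.2 u hAB.1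
        (by rw [(mem_level.1 hA).2]; exact hau)
      rw [(mem_level.1 hA).2, (mem_level.1 hB).2] at hcard
      rw [← hcard]
      congr 1
      ext U
      simp only [L, Finset.mem_filter, Finset.mem_powersetCard, Finset.subset_univ, true_and]
      tauto
    rw [← smul_eq_mul, ← Finset.sum_const, ← Finset.sum_congr rfl this]
    simp only [Finset.card_filter]
    exact Finset.sum_comm
  have h2 : ∀ U ∈ L, ((levelPairs F F a b).filter (fun p => p.1 ⊆ U ∧ U ⊆ p.2)).card ≤
      m * (((level F a).filter (· ⊆ U)).card + ((level F b).filter (U ⊆ ·)).card) := by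
    intro U _
    set P := (level F a).filter (· ⊆ U)
    set Q := (level F b).filter (U ⊆ ·)
    have hle : ((levelPairs F F a b).filter (fun p => p.1 ⊆ U ∧ U ⊆ p.2)).card ≤
        P.card * Q.card := by
      rw [← Finset.card_product]
      refine Finset.card_le_card fun p hp => ?_
      obtain ⟨hp, h1, h2⟩ := Finset.mem_filter.1 hp
      obtain ⟨⟨hA, hB⟩, -⟩ := mem_levelPairs.1 hp
      exact Finset.mem_product.2 ⟨Finset.mem_filter.2 ⟨hA, h1⟩, Finset.mem_filter.2 ⟨hB, h2⟩⟩
    have hmin : P.card ≤ m ∨ Q.card ≤ m := by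
      by_contra! hcon
      refine not_posetFree_of_complete hm (P := P) (Q := Q) (F := F) ?_ ?_ hcon.1.le hcon.2.le ?_ hF
      · exact fun A hA => (mem_level.1 (Finset.mem_filter.1 hA).1).1
      · exact fun A hA => (mem_level.1 (Finset.mem_filter.1 hA).1).1
      · intro A hA B hB
        obtain ⟨hA, hAU⟩ := Finset.mem_filter.1 hA
        obtain ⟨hB, hBU⟩ := Finset.mem_filter.1 hB
        refine (hAU.trans hBU).ssubset_of_ne ?_
        rintro rfl
        have := (mem_level.1 hA).2
        have := (mem_level.1 hB).2
        omega
    refine hle.trans ?_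
    rcases hmin with h | h <;> nlinarith [Nat.zero_le P.card, Nat.zero_le Q.card]
  have h3 : ∑ U ∈ L, ((level F a).filter (· ⊆ U)).card =
      (level F a).card * (n - a).choose (u - a) := by
    simp only [Finset.card_filter]
    rw [Finset.sum_comm, ← smul_eq_mul, ← Finset.sum_const]
    refine Finset.sum_congr rfl fun A hA => ?_
    have := Finset.card_filter_powersetCard_subset A Finset.univ u (Finset.subset_univ _)
      (by rw [(mem_level.1 hA).2]; exact hau)
    rw [(mem_level.1 hA).2, Finset.card_univ, Fintype.card_fin] at this
    rw [← this, Finset.card_filter]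
  have h4 : ∑ U ∈ L, ((level F b).filter (U ⊆ ·)).card = (level F b).card * b.choose u := by
    simp only [Finset.card_filter]
    rw [Finset.sum_comm, ← smul_eq_mul, ← Finset.sum_const]
    refine Finset.sum_congr rfl fun B hB => ?_
    have hc : (Finset.powersetCard u B).card = b.choose u := by
      rw [Finset.card_powersetCard, (mem_level.1 hB).2]
    rw [← hc, ← Finset.card_filter]
    congr 1
    ext U
    simp only [L, Finset.mem_filter, Finset.mem_powersetCard, Finset.subset_univ, true_and]
    tauto
  rw [h1, ← h3, ← h4, ← Finset.sum_add_distrib, Finset.mul_sum]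
  exact Finset.sum_le_sum h2

/-- This normalises the triple count by the total number of triples A ⊆ U ⊆ B in the full cube,
which `e1`, `e2` and `e3` factor starting from A or from B. -/
lemma pairDensity_le_of_between {m : ℕ} (hm : 2 ≤ m) {F : Finset (Finset (Fin n))}
    (hF : PosetFree (Crown m) F) {a u b : ℕ} (hau : a ≤ u) (hub : u ≤ b) (hab : a < b)
    (hbn : b ≤ n) :
    pairDensity F F a b ≤
      m * (density F a / (n - u).choose (b - u) + density F b / u.choose a) := by
  have h := card_levelPairs_mul_choose_le hm hF hau hab
  have e1 : n.choose b * b.choose a = n.choose a * (n - a).choose (b - a) :=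
    Nat.choose_mul hab.le
  have e2 : (n - a).choose (b - a) * (b - a).choose (u - a) =
      (n - a).choose (u - a) * (n - u).choose (b - u) := by
    have := Nat.choose_mul (n := n - a) (k := b - a) (s := u - a) (by omega)
    rwa [show n - a - (u - a) = n - u by omega, show b - a - (u - a) = b - u by omega] at this
  have e3 : b.choose u * u.choose a = b.choose a * (b - a).choose (u - a) := Nat.choose_mul hau
  have p1 : 0 < n.choose b := Nat.choose_pos hbn
  have p2 : 0 < b.choose a := Nat.choose_pos hab.le
  have p3 : 0 < (b - a).choose (u - a) := Nat.choose_pos (by omega)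
  have p4 : 0 < n.choose a := Nat.choose_pos (by omega)
  have p5 : 0 < (n - u).choose (b - u) := Nat.choose_pos (by omega)
  have p6 : 0 < u.choose a := Nat.choose_pos hau
  unfold pairDensity density
  generalize n.choose b = X at *
  generalize b.choose a = Y at *
  generalize (b - a).choose (u - a) = Z at *
  generalize n.choose a = c at *
  generalize (n - u).choose (b - u) = R at *
  generalize u.choose a = Q at *
  generalize (n - a).choose (u - a) = W at *
  generalize b.choose u = V at *
  generalize (n - a).choose (b - a) = M at *
  generalize (levelPairs F F a b).card = N at *
  generalize (level F a).card = A at *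
  generalize (level F b).card = B at *
  have e4 : (X * Y * Z : ℝ) = c * (W * R) := by
    have : X * Y * Z = c * (W * R) := by rw [e1, mul_assoc, e2]
    exact_mod_cast this
  have e5 : (X * Y * Z : ℝ) = X * (V * Q) := by
    have : X * Y * Z = X * (V * Q) := by rw [e3, mul_assoc]
    exact_mod_cast this
  have hr : (N * Z : ℝ) ≤ m * (A * W + B * V) := by exact_mod_cast h
  rify at p1 p2 p3 p4 p5 p6
  have hpos : (0 : ℝ) < X * Y * Z := by positivity
  have hW : (W : ℝ) ≠ 0 := by rintro h0; rw [e4, h0] at hpos; simp at hpos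
  have hV : (V : ℝ) ≠ 0 := by rintro h0; rw [e5, h0] at hpos; simp at hpos
  have h1 : (A : ℝ) / c / R = A * W / (X * Y * Z) := by rw [e4]; field_simp
  have h2 : (B : ℝ) / X / Q = B * V / (X * Y * Z) := by rw [e5]; field_simp
  have h3 : (N : ℝ) / (X * Y) = N * Z / (X * Y * Z) := by field_simp
  rw [h1, h2, h3, ← add_div, ← mul_div_assoc]
  gcongr

/-- All members of the family have size between `n / 4` and `3 n / 4`. -/
def IsMiddle (F : Finset (Finset (Fin n))) : Prop :=
  ∀ A ∈ F, n ≤ 4 * A.card ∧ 4 * A.card ≤ 3 * n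

lemma IsMiddle.pairDensity_eq_zero {F : Finset (Finset (Fin n))} (hF : IsMiddle F) {a b : ℕ}
    (h : ¬ (n ≤ 4 * a ∧ 4 * b ≤ 3 * n ∧ a < b)) : pairDensity F F a b = 0 := by
  have : levelPairs F F a b = ∅ := by
    rw [Finset.eq_empty_iff_forall_notMem]
    intro p hp
    obtain ⟨⟨hA, hB⟩, hAB⟩ := mem_levelPairs.1 hp
    have h1 := hF _ (mem_level.1 hA).1
    have h2 := hF _ (mem_level.1 hB).1
    have h3 := Finset.card_lt_card hAB
    rw [(mem_level.1 hA).2] at h1 h3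
    rw [(mem_level.1 hB).2] at h2 h3
    omega
  simp [pairDensity, this]

/-- Distances 2 and 3 can afford a linear saving, obtained with u = a + 1. Up to n larger distances
have to be summed, so they need a quadratic saving; u = a + 2 then leaves at least two steps on
either side. -/
lemma pairDensity_le_of_mid {m : ℕ} (hm : 2 ≤ m) {F : Finset (Finset (Fin n))}
    (hF : PosetFree (Crown m) F) (hmid : IsMiddle F) (hn : 16 ≤ n) {a b : ℕ} (hab : a + 2 ≤ b) :
    pairDensity F F a b ≤ (if b ≤ a + 3 then 4 * (m / n : ℝ) else 64 * m / (n : ℝ) ^ 2) *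
      (density F a + density F b) := by
  have hfa := density_nonneg F a
  have hfb := density_nonneg F b
  by_cases h : n ≤ 4 * a ∧ 4 * b ≤ 3 * n ∧ a < b
  swap
  · rw [hmid.pairDensity_eq_zero h]
    split_ifs <;> positivity
  obtain ⟨ha, hb, hlt⟩ := h
  have hn0 : (0 : ℝ) < n := by exact_mod_cast (by omega : 0 < n)
  have key : ∀ (u : ℕ) (c : ℝ), 0 < c → a ≤ u → u ≤ b → c ≤ (n - u).choose (b - u) →
      c ≤ u.choose a → pairDensity F F a b ≤ m / c * (density F a + density F b) := by
    intro u c hc hau hub h1 h2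
    refine (pairDensity_le_of_between hm hF hau hub hlt (by omega)).trans ?_
    rw [div_mul_eq_mul_div, mul_div_assoc, add_div]
    gcongr
  split_ifs with hd
  · refine (key (a + 1) (n / 4) (by positivity) (by omega) (by omega) ?_ ?_).trans_eq ?_
    · have h1 : n - (a + 1) ≤ (n - (a + 1)).choose (b - (a + 1)) :=
        le_choose_of_pos (by omega) (by omega)
      have h2 : n ≤ 4 * (n - (a + 1)).choose (b - (a + 1)) := by omega
      rw [div_le_iff₀ (by norm_num), mul_comm]
      exact_mod_cast h2
    · rw [Nat.choose_succ_self_right, div_le_iff₀ (by norm_num), mul_comm]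
      exact_mod_cast (by omega : n ≤ 4 * (a + 1))
    · field_simp
  · have hq : ∀ x j : ℕ, 2 ≤ j → j + 2 ≤ x → n ≤ 4 * x → (n : ℝ) ^ 2 / 64 ≤ x.choose j := by
      intro x j hj hx hnx
      have h1 := mul_pred_le_two_mul_choose hj hx
      obtain ⟨y, rfl⟩ : ∃ y, x = y + 1 := ⟨x - 1, by omega⟩
      rw [Nat.add_sub_cancel] at h1
      rify at h1 hnx
      have hy : (1 : ℝ) ≤ y := by exact_mod_cast (by omega : 1 ≤ y)
      nlinarith
    refine (key (a + 2) (n ^ 2 / 64) (by positivity) (by omega) (by omega) ?_ ?_).trans_eq ?_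
    · exact hq _ _ (by omega) (by omega) (by omega)
    · rw [← Nat.choose_symm (by omega), show a + 2 - a = 2 by omega]
      exact hq _ _ (by omega) (by omega) (by omega)
    · field_simp

/-- At a fixed distance `d`, a level is the lower end of at most one pair of levels and the upper
end of at most one. -/
lemma sum_ite_eq_add_le (f g : ℕ → ℝ) (hf : ∀ r, 0 ≤ f r) (hg : ∀ r, 0 ≤ g r) (N d : ℕ) :
    ∑ b ∈ Finset.range N, ∑ a ∈ Finset.range N, (if b = a + d then f a + g b else 0) ≤
      ∑ r ∈ Finset.range N, f r + ∑ r ∈ Finset.range N, g r := by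
  have h1 : ∑ b ∈ Finset.range N, ∑ a ∈ Finset.range N, (if b = a + d then f a else 0) ≤
      ∑ r ∈ Finset.range N, f r := by
    rw [Finset.sum_comm]
    refine Finset.sum_le_sum fun a _ => ?_
    rw [Finset.sum_ite_eq' (Finset.range N) (a + d) (fun _ => f a)]
    split_ifs
    · exact le_rfl
    · exact hf a
  have h2 : ∑ b ∈ Finset.range N, ∑ a ∈ Finset.range N, (if b = a + d then g b else 0) ≤
      ∑ r ∈ Finset.range N, g r := by
    refine Finset.sum_le_sum fun b _ => ?_
    rw [← Finset.sum_filter, Finset.sum_const, nsmul_eq_mul]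
    refine mul_le_of_le_one_left (hg b) ?_
    have : ((Finset.range N).filter (fun a => b = a + d)).card ≤ 1 :=
      Finset.card_le_one.2 fun x hx y hy => by
        have := (Finset.mem_filter.1 hx).2
        have := (Finset.mem_filter.1 hy).2
        omega
    exact_mod_cast this
  have : ∀ a b, (if b = a + d then f a + g b else 0) =
      (if b = a + d then f a else 0) + (if b = a + d then g b else 0) := by
    intro a b; split_ifs <;> simp
  simp only [this, Finset.sum_add_distrib]
  linarith

lemma lubell_nonneg (F : Finset (Finset (Fin n))) : 0 ≤ lubell F :=
  Finset.sum_nonneg fun r _ => density_nonneg F r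

/-- The pairs of members of a crown-free family at distance at least two contribute little. -/
lemma sum_pairDensity_far_le {m : ℕ} (hm : 2 ≤ m) {F : Finset (Finset (Fin n))}
    (hF : PosetFree (Crown m) F) (hmid : IsMiddle F) (hn : 16 ≤ n) :
    ∑ b ∈ Finset.range (n + 1), ∑ a ∈ Finset.range (n + 1),
      (if a + 2 ≤ b then pairDensity F F a b else 0) ≤ 272 * (m / n : ℝ) * lubell F := by
  have hn0 : (0 : ℝ) < n := by exact_mod_cast (by omega : 0 < n)
  have hpt : ∀ b ∈ Finset.range (n + 1), ∀ a ∈ Finset.range (n + 1),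
      (if a + 2 ≤ b then pairDensity F F a b else 0) ≤
        4 * (m / n : ℝ) * (if b = a + 2 then density F a + density F b else 0) +
        4 * (m / n : ℝ) * (if b = a + 3 then density F a + density F b else 0) +
        64 * m / (n : ℝ) ^ 2 * (density F a + density F b) := by
    intro b _ a _
    have hfa := density_nonneg F a
    have hfb := density_nonneg F b
    have h3 : 0 ≤ 64 * m / (n : ℝ) ^ 2 * (density F a + density F b) := by positivity
    have h4 : 0 ≤ 4 * (m / n : ℝ) * (density F a + density F b) := by positivity
    split_ifs with h1 h2 h2' h2' h5 h6 h7
    all_goals try omega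
    all_goals try simp only [mul_zero, zero_add, add_zero]
    all_goals try positivity
    all_goals
      have := pairDensity_le_of_mid hm hF hmid hn h1
      split_ifs at this
      all_goals first | omega | linarith
  refine (Finset.sum_le_sum fun b hb => Finset.sum_le_sum (hpt b hb)).trans ?_
  simp only [Finset.sum_add_distrib, ← Finset.mul_sum]
  have h2 := sum_ite_eq_add_le (density F) (density F) (density_nonneg F)
    (density_nonneg F) (n + 1) 2
  have h3 := sum_ite_eq_add_le (density F) (density F) (density_nonneg F)
    (density_nonneg F) (n + 1) 3
  simp only [Finset.sum_const, Finset.card_range, nsmul_eq_mul, ← Finset.mul_sum]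
  change _ ≤ lubell F + lubell F at h2
  change _ ≤ lubell F + lubell F at h3
  have hE : ∑ r ∈ Finset.range (n + 1), density F r = lubell F := rfl
  rw [hE]
  have hEn := lubell_nonneg F
  have hc : 0 ≤ 4 * (m / n : ℝ) := by positivity
  have h2' := mul_le_mul_of_nonneg_left h2 hc
  have h3' := mul_le_mul_of_nonneg_left h3 hc
  have h4 : 64 * m / (n : ℝ) ^ 2 * (((n + 1 : ℕ) : ℝ) * lubell F + ((n + 1 : ℕ) : ℝ) * lubell F) ≤
      256 * (m / n : ℝ) * lubell F := by
    have e : 64 * m / (n : ℝ) ^ 2 * (((n + 1 : ℕ) : ℝ) * lubell F + ((n + 1 : ℕ) : ℝ) * lubell F) =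
        (128 * (m / n : ℝ) * lubell F) * (((n + 1 : ℕ) : ℝ) / n) := by
      field_simp; ring
    rw [e]
    have : ((n + 1 : ℕ) : ℝ) / n ≤ 2 := by
      rw [div_le_iff₀ hn0]; push_cast
      have : (1 : ℝ) ≤ n := by exact_mod_cast (by omega : 1 ≤ n)
      linarith
    have h0 : 0 ≤ 128 * (m / n : ℝ) * lubell F := by positivity
    nlinarith
  linarith

end

/-! ### Consecutive levels: link graphs and Cauchy–Schwarz -/

section

variable {n : ℕ}

lemma exists_erase_of_ssubset {A B : Finset (Fin n)} (h : A ⊂ B) (hc : A.card + 1 = B.card) :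
    ∃ x ∈ B, B.erase x = A := by
  obtain ⟨x, hx, hAx⟩ := Finset.ssubset_iff_exists_subset_erase.1 h
  refine ⟨x, hx, (Finset.eq_of_subset_of_card_le hAx ?_).symm⟩
  rw [Finset.card_erase_of_mem hx]
  omega

lemma card_lower_eq (P : Finset (Finset (Fin n))) {r : ℕ} {B : Finset (Fin n)}
    (hB : B.card = r + 1) :
    ((level P r).filter (· ⊂ B)).card = (B.filter (fun x => B.erase x ∈ P)).card := by
  have : (level P r).filter (· ⊂ B) = (B.filter (fun x => B.erase x ∈ P)).image B.erase := by
    ext A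
    simp only [Finset.mem_filter, mem_level, Finset.mem_image]
    constructor
    · rintro ⟨⟨hA, hc⟩, hAB⟩
      obtain ⟨x, hx, rfl⟩ := exists_erase_of_ssubset hAB (by omega)
      exact ⟨x, ⟨hx, hA⟩, rfl⟩
    · rintro ⟨x, ⟨hx, hP⟩, rfl⟩
      refine ⟨⟨hP, ?_⟩, Finset.erase_ssubset hx⟩
      rw [Finset.card_erase_of_mem hx]
      omega
  rw [this, Finset.card_image_of_injOn]
  intro x hx y _ hxy
  exact (Finset.erase_inj B (Finset.mem_filter.1 hx).1).1 hxy

lemma card_upper_le (Q : Finset (Finset (Fin n))) {r : ℕ} {A : Finset (Fin n)}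
    (hA : A.card = r) :
    ((level Q (r + 1)).filter (A ⊂ ·)).card ≤ n - r := by
  have h1 : (level Q (r + 1)).filter (A ⊂ ·) ⊆ Aᶜ.image (fun x => insert x A) := by
    intro B hB
    obtain ⟨hB, hAB⟩ := Finset.mem_filter.1 hB
    obtain ⟨x, hx, rfl⟩ := exists_erase_of_ssubset hAB (by rw [hA, (mem_level.1 hB).2])
    exact Finset.mem_image.2 ⟨x, by simp, Finset.insert_erase hx⟩
  refine (Finset.card_le_card h1).trans (Finset.card_image_le.trans ?_)
  rw [Finset.card_compl, Fintype.card_fin, hA]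

/-- The elements that can be added to `S` to give a member of `P`. -/
def extensions (P : Finset (Finset (Fin n))) (S : Finset (Fin n)) : Finset (Fin n) :=
  Sᶜ.filter (fun x => insert x S ∈ P)

lemma mem_extensions {P : Finset (Finset (Fin n))} {S : Finset (Fin n)} {x : Fin n} :
    x ∈ extensions P S ↔ x ∉ S ∧ insert x S ∈ P := by
  simp [extensions]

lemma sum_card_extensions_le (P : Finset (Finset (Fin n))) {r : ℕ} (hr : 1 ≤ r) :
    ∑ S ∈ Finset.powersetCard (r - 1) Finset.univ, (extensions P S).card ≤
      (level P r).card * r := by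
  have h1 : (level P r).card * r = ((level P r).sigma (fun A => A)).card := by
    rw [Finset.card_sigma, ← smul_eq_mul, ← Finset.sum_const]
    exact Finset.sum_congr rfl fun A hA => (mem_level.1 hA).2.symm
  rw [h1, ← Finset.card_sigma]
  refine Finset.card_le_card_of_injOn (fun p => ⟨insert p.2 p.1, p.2⟩) ?_ ?_
  · rintro ⟨S, x⟩ h
    obtain ⟨hS, hx⟩ := Finset.mem_sigma.1 h
    obtain ⟨hxS, hP⟩ := mem_extensions.1 hx
    have hS := (Finset.mem_powersetCard.1 hS).2
    refine Finset.mem_sigma.2 ⟨mem_level.2 ⟨hP, ?_⟩, Finset.mem_insert_self _ _⟩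
    rw [Finset.card_insert_of_notMem hxS]
    change S.card = r - 1 at hS
    change S.card + 1 = r
    omega
  · rintro ⟨S, x⟩ h ⟨S', x'⟩ h' heq
    obtain ⟨-, hx⟩ := Finset.mem_sigma.1 h
    obtain ⟨-, hx'⟩ := Finset.mem_sigma.1 h'
    have hxS := (mem_extensions.1 hx).1
    have hxS' := (mem_extensions.1 hx').1
    simp only [Sigma.mk.injEq, heq_eq_eq] at heq hxS hxS' ⊢
    obtain ⟨h1, rfl⟩ := heq
    refine ⟨?_, rfl⟩
    rw [← Finset.erase_insert hxS, h1, Finset.erase_insert hxS']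

lemma card_extensions_le (P : Finset (Finset (Fin n))) (S : Finset (Fin n)) :
    (extensions P S).card ≤ n - S.card := by
  refine (Finset.card_filter_le _ _).trans ?_
  rw [Finset.card_compl, Fintype.card_fin]

-- The square of the number of lower covers of B counts ordered pairs of them. The diagonal gives
-- `levelPairs`; distinct covers B - x and B - y become the edge (y, x) of the link graph of S = B -
-- x - y, from which B is recovered.
open Classical in
lemma sum_card_lower_sq_le (P Q : Finset (Finset (Fin n))) {r : ℕ} (hr : 1 ≤ r) :
    ∑ B ∈ level Q (r + 1), ((level P r).filter (· ⊂ B)).card ^ 2 ≤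
      (levelPairs P Q r (r + 1)).card +
        ∑ S ∈ Finset.powersetCard (r - 1) Finset.univ, ∑ v ∈ extensions P S,
          ((extensions P S).filter ((linkGraph Q S).Adj v)).card := by
  rw [card_levelPairs_eq_sum_right]
  have hd : ∀ B ∈ level Q (r + 1), ((level P r).filter (· ⊂ B)).card ^ 2 =
      ((level P r).filter (· ⊂ B)).card + (B.filter (fun x => B.erase x ∈ P)).offDiag.card := by
    intro B hB
    rw [card_lower_eq P (mem_level.1 hB).2, Finset.offDiag_card, sq]
    have := Nat.le_mul_self (B.filter (fun x => B.erase x ∈ P)).card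
    omega
  rw [Finset.sum_congr rfl hd, Finset.sum_add_distrib]
  refine Nat.add_le_add_left ?_ _
  simp only [← Finset.card_sigma]
  refine Finset.card_le_card_of_injOn
    (fun p => (⟨(p.1.erase p.2.1).erase p.2.2, ⟨p.2.2, p.2.1⟩⟩ :
      Σ _ : Finset (Fin n), Σ _ : Fin n, Fin n)) ?_ ?_
  · rintro ⟨B, x, y⟩ h
    obtain ⟨hB, hxy⟩ := Finset.mem_sigma.1 h
    obtain ⟨hx, hy, hne⟩ := Finset.mem_offDiag.1 hxy
    obtain ⟨hxB, hxP⟩ := Finset.mem_filter.1 hx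
    obtain ⟨hyB, hyP⟩ := Finset.mem_filter.1 hy
    obtain ⟨hBQ, hBc⟩ := mem_level.1 hB
    simp only at hxB hxP hyB hyP hne hBQ hBc
    have hyx : y ∈ B.erase x := Finset.mem_erase.2 ⟨hne.symm, hyB⟩
    have hxy' : x ∈ B.erase y := Finset.mem_erase.2 ⟨hne, hxB⟩
    have e1 : insert y ((B.erase x).erase y) = B.erase x := Finset.insert_erase hyx
    have e2 : insert x ((B.erase x).erase y) = B.erase y := by
      rw [Finset.erase_right_comm]; exact Finset.insert_erase hxy'
    have ey : y ∈ extensions P ((B.erase x).erase y) :=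
      mem_extensions.2 ⟨by simp, by rwa [e1]⟩
    have ex : x ∈ extensions P ((B.erase x).erase y) :=
      mem_extensions.2 ⟨by simp, by rwa [e2]⟩
    refine Finset.mem_sigma.2 ⟨Finset.mem_powersetCard.2 ⟨Finset.subset_univ _, ?_⟩,
      Finset.mem_sigma.2 ⟨ey, Finset.mem_filter.2 ⟨ex, hne.symm, ?_⟩⟩⟩
    · simp only
      rw [Finset.card_erase_of_mem hyx, Finset.card_erase_of_mem hxB]
      omega
    · simp only
      rw [e2, Finset.insert_erase hyB]
      exact hBQ
  · rintro ⟨B, x, y⟩ h ⟨B', x', y'⟩ h' heq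
    have key : ∀ (B : Finset (Fin n)) (x y : Fin n), (⟨B, x, y⟩ : Σ _ : Finset (Fin n),
        Fin n × Fin n) ∈ (level Q (r + 1)).sigma
          (fun B => (B.filter (fun x => B.erase x ∈ P)).offDiag) →
        B = insert x (insert y ((B.erase x).erase y)) := by
      intro B x y h
      obtain ⟨-, hxy⟩ := Finset.mem_sigma.1 h
      obtain ⟨hx, hy, hne⟩ := Finset.mem_offDiag.1 hxy
      rw [Finset.insert_erase, Finset.insert_erase (Finset.mem_filter.1 hx).1]
      exact Finset.mem_erase.2 ⟨hne.symm, (Finset.mem_filter.1 hy).1⟩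
    have hB := key B x y h
    have hB' := key B' x' y' h'
    simp only [Sigma.mk.injEq, heq_eq_eq] at heq
    obtain ⟨h1, rfl, rfl⟩ := heq
    rw [h1] at hB
    rw [hB, ← hB']

open Classical in
/-- `m`-cycle-free graphs on `v` vertices have at most `v (β v + K)` ordered pairs of adjacent
vertices. -/
def CycleDensityBound (m : ℕ) (β K : ℝ) : Prop :=
  ∀ {α : Type} (G : SimpleGraph α) (V : Finset α), ¬ HasCycleIn G V m →
    (∑ v ∈ V, ((V.filter (G.Adj v)).card : ℝ)) ≤ V.card * (β * V.card + K)

/-- Cauchy–Schwarz over the upper sets reduces to pairs of lower covers, that is, to edges of link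
graphs. These have no m-cycle on the extensions of S, of which there are at most n - r + 1. -/
lemma card_levelPairs_sq_le {m : ℕ} (hm : 3 ≤ m) {β K : ℝ} (hβ : 0 ≤ β) (hK : 0 ≤ K)
    (hcyc : CycleDensityBound m β K) {F P Q : Finset (Finset (Fin n))}
    (hF : PosetFree (Crown m) F) (hP : P ⊆ F) (hQ : Q ⊆ F) {r : ℕ} (hr : 1 ≤ r) (hrn : r ≤ n) :
    ((levelPairs P Q r (r + 1)).card : ℝ) ^ 2 ≤
      (level Q (r + 1)).card * ((level P r).card *
        (r * (β * (n - r + 1) + K) + (n - r))) := by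
  classical
  have h1 : ((levelPairs P Q r (r + 1)).card : ℝ) ^ 2 ≤ (level Q (r + 1)).card *
      ∑ B ∈ level Q (r + 1), (((level P r).filter (· ⊂ B)).card : ℝ) ^ 2 := by
    rw [card_levelPairs_eq_sum_right]
    push_cast
    exact sq_sum_le_card_mul_sum_sq
  have h2 : ∑ B ∈ level Q (r + 1), (((level P r).filter (· ⊂ B)).card : ℝ) ^ 2 ≤
      (levelPairs P Q r (r + 1)).card +
        ∑ S ∈ Finset.powersetCard (r - 1) Finset.univ, ∑ v ∈ extensions P S,
          (((extensions P S).filter ((linkGraph Q S).Adj v)).card : ℝ) := by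
    exact_mod_cast sum_card_lower_sq_le P Q hr
  have h3 : ((levelPairs P Q r (r + 1)).card : ℝ) ≤ (level P r).card * (n - r) := by
    rw [← Nat.cast_sub hrn, ← Nat.cast_mul, Nat.cast_le, card_levelPairs_eq_sum_left,
      ← smul_eq_mul]
    exact Finset.sum_le_card_nsmul _ _ _ fun A hA => card_upper_le Q (mem_level.1 hA).2
  have h4 : ∀ S ∈ Finset.powersetCard (r - 1) (Finset.univ : Finset (Fin n)),
      ∑ v ∈ extensions P S, (((extensions P S).filter ((linkGraph Q S).Adj v)).card : ℝ) ≤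
        (extensions P S).card * (β * (n - r + 1) + K) := by
    intro S hS
    have hno : ¬ HasCycleIn (linkGraph Q S) (extensions P S) m := fun h =>
      not_posetFree_of_hasCycleIn hm hP hQ (fun x hx => (mem_extensions.1 hx).1)
        (fun x hx => (mem_extensions.1 hx).2) h hF
    refine (hcyc _ _ hno).trans ?_
    have hle := card_extensions_le P S
    rw [(Finset.mem_powersetCard.1 hS).2] at hle
    have : ((extensions P S).card : ℝ) ≤ n - r + 1 := by
      have h' : (extensions P S).card + r ≤ n + 1 := by omega
      rify at h'
      linarith
    gcongr
  have h5 : ∑ S ∈ Finset.powersetCard (r - 1) (Finset.univ : Finset (Fin n)),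
      ((extensions P S).card : ℝ) ≤ (level P r).card * r := by
    exact_mod_cast sum_card_extensions_le P hr
  have hnr : (r : ℝ) ≤ n := by exact_mod_cast hrn
  have hc : 0 ≤ β * (n - r + 1) + K := by
    have : (0 : ℝ) ≤ n - r + 1 := by linarith
    positivity
  refine h1.trans (mul_le_mul_of_nonneg_left (h2.trans ?_) (Nat.cast_nonneg _))
  refine (add_le_add h3 ((Finset.sum_le_sum h4).trans_eq (Finset.sum_mul _ _ _).symm)).trans ?_
  have := mul_le_mul_of_nonneg_right h5 hc
  linarith

lemma pairDensity_succ_sq_le {m : ℕ} (hm : 3 ≤ m) {β K : ℝ} (hβ : 0 ≤ β) (hK : 0 ≤ K)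
    (hcyc : CycleDensityBound m β K) {F P Q : Finset (Finset (Fin n))}
    (hF : PosetFree (Crown m) F) (hP : P ⊆ F) (hQ : Q ⊆ F) {r : ℕ} (hr : 1 ≤ r)
    (hrn : n ≤ 4 * r) (hrn' : 4 * (r + 1) ≤ 3 * n) :
    pairDensity P Q r (r + 1) ^ 2 ≤
      (β + 4 * (β + K + 1) / n) * (density P r * density Q (r + 1)) := by
  have h := card_levelPairs_sq_le hm hβ hK hcyc hF hP hQ hr (by omega)
  have e1 : (n.choose (r + 1) : ℝ) * (r + 1) = n.choose r * (n - r) := by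
    rw [← Nat.cast_sub (by omega)]
    exact_mod_cast Nat.choose_succ_right_eq n r
  have p1 : (0 : ℝ) < n.choose (r + 1) := by exact_mod_cast Nat.choose_pos (by omega)
  have p2 : (0 : ℝ) < n.choose r := by exact_mod_cast Nat.choose_pos (by omega)
  have p3 : (0 : ℝ) < n := by exact_mod_cast (by omega : 0 < n)
  have q1 : (n : ℝ) ≤ 4 * (r + 1) := by exact_mod_cast (by omega : n ≤ 4 * (r + 1))
  have q2 : (n : ℝ) ≤ 4 * (n - r) := by
    have : n + 4 * r ≤ 4 * n := by omega
    rify at this; linarith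
  have p4 : (0 : ℝ) < n - r := by linarith
  unfold pairDensity density
  rw [Nat.choose_succ_self_right]
  push_cast
  have e2 : ((n.choose (r + 1) : ℝ) * (r + 1)) ^ 2 =
      (n.choose (r + 1) * (r + 1)) * (n.choose r * (n - r)) := by rw [sq, ← e1]
  rw [div_pow, e2, div_le_iff₀ (by positivity)]
  refine h.trans ?_
  have e3 : (β + 4 * (β + K + 1) / n) * ((level P r).card / (n.choose r : ℝ) *
      ((level Q (r + 1)).card / (n.choose (r + 1) : ℝ))) *
      ((n.choose (r + 1) * (r + 1)) * (n.choose r * (n - r))) =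
      (level Q (r + 1)).card * ((level P r).card *
        ((β + 4 * (β + K + 1) / n) * ((r + 1) * (n - r)))) := by
    field_simp
  rw [e3]
  refine mul_le_mul_of_nonneg_left (mul_le_mul_of_nonneg_left ?_ (Nat.cast_nonneg _))
    (Nat.cast_nonneg _)
  -- In the middle levels both r + 1 and n - r are at least n/4, so every term linear in one of them
  -- is O(1/n) of their product.
  have t1 : (r + 1 : ℝ) ≤ 4 / n * ((r + 1) * (n - r)) := by
    rw [div_mul_eq_mul_div, le_div_iff₀ p3]
    nlinarith
  have t2 : (n - r : ℝ) ≤ 4 / n * ((r + 1) * (n - r)) := by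
    rw [div_mul_eq_mul_div, le_div_iff₀ p3]
    nlinarith
  have t3 := mul_le_mul_of_nonneg_left t1 (add_nonneg hβ hK)
  have e4 : (β + 4 * (β + K + 1) / n) * ((r + 1) * (n - r)) = β * ((r + 1) * (n - r)) +
      (β + K) * (4 / n * ((r + 1) * (n - r))) + 4 / n * ((r + 1) * (n - r)) := by
    field_simp; ring
  rw [e4]
  have := mul_nonneg hβ p4.le
  nlinarith

/-- AM-GM makes the bound additive in `P` and `Q`, so that it can be summed over levels; the factor
1/2 survives because `P` and `Q` will be complementary. -/
lemma pairDensity_succ_le {m : ℕ} (hm : 3 ≤ m) {β K γ : ℝ} (hβ : 0 ≤ β) (hK : 0 ≤ K)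
    (hcyc : CycleDensityBound m β K) (hγ : 0 ≤ γ) (hγβ : β + 4 * (β + K + 1) / n ≤ γ ^ 2)
    {F P Q : Finset (Finset (Fin n))}
    (hF : PosetFree (Crown m) F) (hP : P ⊆ F) (hQ : Q ⊆ F) {r : ℕ} (hr : 1 ≤ r)
    (hrn : n ≤ 4 * r) (hrn' : 4 * (r + 1) ≤ 3 * n) :
    pairDensity P Q r (r + 1) ≤ γ / 2 * (density P r + density Q (r + 1)) := by
  have h := pairDensity_succ_sq_le hm hβ hK hcyc hF hP hQ hr hrn hrn'
  have hP0 := density_nonneg P r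
  have hQ0 := density_nonneg Q (r + 1)
  refine le_of_sq_le_sq (h.trans ?_) (by positivity)
  have h1 := mul_le_mul_of_nonneg_right hγβ (mul_nonneg hP0 hQ0)
  refine h1.trans ?_
  have : (γ / 2 * (density P r + density Q (r + 1))) ^ 2 =
    γ ^ 2 * ((density P r + density Q (r + 1)) ^ 2 / 4) := by ring
  rw [this]
  refine mul_le_mul_of_nonneg_left ?_ (sq_nonneg γ)
  nlinarith [sq_nonneg (density P r - density Q (r + 1))]

end

/-! ### Splitting the family by the number of lower covers -/

section

variable {n : ℕ}

/-- The members of `F` with at most `m` lower covers in `F`. -/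
def fewLower (m : ℕ) (F : Finset (Finset (Fin n))) : Finset (Finset (Fin n)) :=
  F.filter (fun C => (F.filter (fun A => A ⊂ C ∧ A.card + 1 = C.card)).card ≤ m)

/-- More than `m` lower and more than `m` upper covers around C would be completely comparable and
contain the crown. -/
lemma card_upper_le_of_not_fewLower {m : ℕ} (hm : 2 ≤ m) {F : Finset (Finset (Fin n))}
    (hF : PosetFree (Crown m) F) {C : Finset (Fin n)} (hC : C ∈ F \ fewLower m F) :
    ((level F (C.card + 1)).filter (C ⊂ ·)).card ≤ m := by
  by_contra! hcon
  obtain ⟨hCF, hC⟩ := Finset.mem_sdiff.1 hC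
  have hlow : m < (F.filter (fun A => A ⊂ C ∧ A.card + 1 = C.card)).card := by
    by_contra! h
    exact hC (Finset.mem_filter.2 ⟨hCF, h⟩)
  refine not_posetFree_of_complete hm (Finset.filter_subset _ _)
    ((Finset.filter_subset _ _).trans (Finset.filter_subset _ _)) hlow.le hcon.le ?_ hF
  intro A hA B hB
  exact (Finset.mem_filter.1 hA).2.1.trans (Finset.mem_filter.1 hB).2

lemma density_add_sdiff {F F' : Finset (Finset (Fin n))} (h : F' ⊆ F) (r : ℕ) :
    density F' r + density (F \ F') r = density F r := by
  unfold density
  rw [← add_div]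
  congr 1
  have h1 : level F' r ∪ level (F \ F') r = level F r := by
    unfold level; rw [← Finset.filter_union, Finset.union_sdiff_of_subset h]
  have h2 : Disjoint (level F' r) (level (F \ F') r) :=
    Finset.disjoint_filter_filter Finset.disjoint_sdiff
  rw [← h1, Finset.card_union_of_disjoint h2]
  push_cast; rfl

/-- Of the r + 1 ≥ n/4 lower covers of an upper set, at most `m` lie in `F`. -/
lemma pairDensity_fewLower_le {m : ℕ} {F : Finset (Finset (Fin n))} {r : ℕ}
    (hn : 0 < n) (hrn : n ≤ 4 * r) :
    pairDensity F (fewLower m F) r (r + 1) ≤ 4 * (m / n : ℝ) * density F (r + 1) := by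
  have h1 : (levelPairs F (fewLower m F) r (r + 1)).card ≤ (level F (r + 1)).card * m := by
    rw [card_levelPairs_eq_sum_right]
    refine (Finset.sum_le_card_nsmul _ _ m fun B hB => ?_).trans ?_
    · obtain ⟨hB, hBc⟩ := mem_level.1 hB
      refine le_trans (Finset.card_le_card fun A hA => ?_) (Finset.mem_filter.1 hB).2
      obtain ⟨hA, hAB⟩ := Finset.mem_filter.1 hA
      obtain ⟨hA, hAc⟩ := mem_level.1 hA
      exact Finset.mem_filter.2 ⟨hA, hAB, by rw [hAc, hBc]⟩
    · rw [smul_eq_mul]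
      exact Nat.mul_le_mul_right _
        (Finset.card_le_card (Finset.filter_subset_filter _ (Finset.filter_subset _ _)))
  have h1' : ((levelPairs F (fewLower m F) r (r + 1)).card : ℝ) ≤ (level F (r + 1)).card * m := by
    exact_mod_cast h1
  unfold pairDensity density
  rw [Nat.choose_succ_self_right, ← div_div]
  have hn' : (0 : ℝ) < n := by exact_mod_cast hn
  have hr : (n : ℝ) / 4 ≤ ((r + 1 : ℕ) : ℝ) := by
    rw [div_le_iff₀ (by norm_num), mul_comm]; exact_mod_cast (by omega : n ≤ 4 * (r + 1))
  calc _ ≤ ((level F (r + 1)).card * m : ℝ) / n.choose (r + 1) / (n / 4) := by gcongr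
    _ = _ := by ring

lemma pairDensity_sdiff_fewLower_le {m : ℕ} (hm : 2 ≤ m) {F : Finset (Finset (Fin n))}
    (hF : PosetFree (Crown m) F) {r : ℕ} (hn : 0 < n) (hrn : 4 * (r + 1) ≤ 3 * n) :
    pairDensity (F \ fewLower m F) F r (r + 1) ≤ 4 * (m / n : ℝ) * density F r := by
  have h1 : (levelPairs (F \ fewLower m F) F r (r + 1)).card ≤ (level F r).card * m := by
    rw [card_levelPairs_eq_sum_left]
    refine (Finset.sum_le_card_nsmul _ _ m fun A hA => ?_).trans ?_
    · obtain ⟨hAF, rfl⟩ := mem_level.1 hA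
      exact card_upper_le_of_not_fewLower hm hF hAF
    · rw [smul_eq_mul]
      exact Nat.mul_le_mul_right _
        (Finset.card_le_card (Finset.filter_subset_filter _ Finset.sdiff_subset))
  have h1' : ((levelPairs (F \ fewLower m F) F r (r + 1)).card : ℝ) ≤ (level F r).card * m := by
    exact_mod_cast h1
  have e1 : (n.choose (r + 1) : ℝ) * (r + 1 : ℕ) = n.choose r * (n - r : ℕ) := by
    exact_mod_cast Nat.choose_succ_right_eq n r
  unfold pairDensity density
  rw [Nat.choose_succ_self_right, e1, ← div_div]
  have hn' : (0 : ℝ) < n := by exact_mod_cast hn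
  have hr : (n : ℝ) / 4 ≤ ((n - r : ℕ) : ℝ) := by
    rw [div_le_iff₀ (by norm_num), mul_comm]; exact_mod_cast (by omega : n ≤ 4 * (n - r))
  calc _ ≤ ((level F r).card * m : ℝ) / n.choose r / (n / 4) := by gcongr
    _ = _ := by ring

/-- A pair that does not go up from `F'` to its complement has its upper member in `F'` or its lower
member outside; with `F' = fewLower m F` both kinds are rare. -/
lemma pairDensity_le_add_three (F F' : Finset (Finset (Fin n))) (a b : ℕ) :
    pairDensity F F a b ≤ pairDensity F' (F \ F') a b + pairDensity F F' a b +
      pairDensity (F \ F') F a b := by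
  unfold pairDensity
  rw [← add_div, ← add_div]
  gcongr
  have : levelPairs F F a b ⊆ (levelPairs F' (F \ F') a b ∪ levelPairs F F' a b) ∪
      levelPairs (F \ F') F a b := by
    intro p hp
    simp only [Finset.mem_union, mem_levelPairs, mem_level, Finset.mem_sdiff] at hp ⊢
    tauto
  have h := (Finset.card_le_card this).trans
    ((Finset.card_union_le _ _).trans (Nat.add_le_add_right (Finset.card_union_le _ _) _))
  exact_mod_cast h

/-- The Lubell weight of a crown-free family in the middle levels. -/
lemma lubell_le_of_posetFree {m : ℕ} (hm : 3 ≤ m) {β K γ : ℝ} (hβ : 0 ≤ β) (hK : 0 ≤ K)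
    (hcyc : CycleDensityBound m β K) (hγ : 0 ≤ γ) (hγβ : β + 4 * (β + K + 1) / n ≤ γ ^ 2)
    {F : Finset (Finset (Fin n))} (hF : PosetFree (Crown m) F) (hmid : IsMiddle F)
    (hn : 16 ≤ n) : lubell F ≤ 1 + (γ / 2 + 280 * (m / n : ℝ)) * lubell F := by
  have hn0 : (0 : ℝ) < n := by exact_mod_cast (by omega : 0 < n)
  set P := fewLower m F with hPdef
  have hPF : P ⊆ F := Finset.filter_subset _ _
  have hQF : F \ P ⊆ F := Finset.sdiff_subset
  set c : ℝ := 4 * (m / n : ℝ) with hc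
  have hc0 : 0 ≤ c := by positivity
  -- `f` is the charge to a level as lower end of a pair and `g` as upper end. Their main terms
  -- involve complementary families, so together they charge γ/2 times the density of `F`, not γ
  -- times.
  set f : ℕ → ℝ := fun r => γ / 2 * density P r + c * density F r with hf
  set g : ℕ → ℝ := fun r => γ / 2 * density (F \ P) r + c * density F r with hg
  have hf0 : ∀ r, 0 ≤ f r := fun r => by
    have := density_nonneg P r; have := density_nonneg F r; positivity
  have hg0 : ∀ r, 0 ≤ g r := fun r => by
    have := density_nonneg (F \ P) r; have := density_nonneg F r; positivity
  have hnear : ∀ r, pairDensity F F r (r + 1) ≤ f r + g (r + 1) := by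
    intro r
    by_cases h : n ≤ 4 * r ∧ 4 * (r + 1) ≤ 3 * n ∧ r < r + 1
    · obtain ⟨h1, h2, -⟩ := h
      have t1 := pairDensity_succ_le hm hβ hK hcyc hγ hγβ hF hPF hQF (by omega) h1 h2
      have t2 : pairDensity F P r (r + 1) ≤ _ := pairDensity_fewLower_le (by omega) h1
      have t3 : pairDensity (F \ P) F r (r + 1) ≤ _ :=
        pairDensity_sdiff_fewLower_le (by omega) hF (by omega) h2
      have t4 := pairDensity_le_add_three F P r (r + 1)
      simp only [hf, hg]
      linarith
    · rw [hmid.pairDensity_eq_zero h]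
      exact add_nonneg (hf0 _) (hg0 _)
  have hsplit : ∑ b ∈ Finset.range (n + 1), ∑ a ∈ Finset.range (n + 1), pairDensity F F a b ≤
      ∑ b ∈ Finset.range (n + 1), ∑ a ∈ Finset.range (n + 1),
        (if a + 2 ≤ b then pairDensity F F a b else 0) +
      ∑ b ∈ Finset.range (n + 1), ∑ a ∈ Finset.range (n + 1),
        (if b = a + 1 then f a + g b else 0) := by
    simp only [← Finset.sum_add_distrib]
    refine Finset.sum_le_sum fun b _ => Finset.sum_le_sum fun a _ => ?_
    rcases Nat.lt_or_ge a b with hlt | hge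
    · rcases Nat.lt_or_ge (a + 1) b with h2 | h2
      · rw [if_pos (show a + 2 ≤ b from h2), if_neg (by omega), add_zero]
      · obtain rfl : b = a + 1 := by omega
        rw [if_neg (by omega), if_pos rfl, zero_add]
        exact hnear a
    · rw [hmid.pairDensity_eq_zero (by omega), if_neg (by omega), if_neg (by omega), add_zero]
  have h1 := lubell_le_one_add_pairDensity F
  have h2 := sum_pairDensity_far_le (by omega) hF hmid hn
  have h3 := sum_ite_eq_add_le f g hf0 hg0 (n + 1) 1
  have h4 : ∑ r ∈ Finset.range (n + 1), f r + ∑ r ∈ Finset.range (n + 1), g r =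
      (γ / 2 + 2 * c) * lubell F := by
    rw [← Finset.sum_add_distrib, lubell, Finset.mul_sum]
    refine Finset.sum_congr rfl fun r _ => ?_
    rw [← density_add_sdiff hPF r]
    simp only [hf, hg]
    rw [← density_add_sdiff hPF r]
    ring
  rw [h4] at h3
  -- 280 = 272 + 2 · 4: the distant pairs, and the error `c` once in `f` and once in `g`.
  have h5 : (γ / 2 + 280 * (m / n : ℝ)) * lubell F =
      (γ / 2 + 2 * c) * lubell F + 272 * (m / n : ℝ) * lubell F := by rw [hc]; ring
  linarith

/-! ### From Lubell weight to cardinality; sets outside the middle levels -/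

lemma card_le_choose_mul_lubell (F : Finset (Finset (Fin n))) :
    (F.card : ℝ) ≤ n.choose (n / 2) * lubell F := by
  rw [lubell_eq, Finset.mul_sum, Finset.card_eq_sum_ones]
  push_cast
  refine Finset.sum_le_sum fun A _ => ?_
  have hle : A.card ≤ n := by simpa using Finset.card_le_univ A
  have h1 : (0 : ℝ) < n.choose A.card := by exact_mod_cast Nat.choose_pos hle
  rw [mul_one_div, le_div_iff₀ h1, one_mul]
  exact_mod_cast Nat.choose_le_middle _ _

/-- The number of sets outside the middle levels. -/
lemma card_filter_not_middle_le (n : ℕ) :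
    ((Finset.univ.filter (fun A : Finset (Fin n) =>
      ¬ (n ≤ 4 * A.card ∧ 4 * A.card ≤ 3 * n))).card : ℝ) ≤ 2 * (337 / 192 : ℝ) ^ n := by
  -- Exponential weighting: (27/64)(4/3)^3 = 1, so the weight is at least 1 once k ≤ n/4, while the
  -- total weight has base 27/64 + 4/3 = 337/192 < 2.
  have hw : ∀ k l : ℕ, k + l = n → 4 * k ≤ n →
      (1 : ℝ) ≤ (27 / 64 : ℝ) ^ k * (4 / 3 : ℝ) ^ l := by
    intro k l hkl hk
    obtain ⟨j, rfl⟩ : ∃ j, l = 3 * k + j := ⟨l - 3 * k, by omega⟩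
    rw [pow_add, pow_mul, ← mul_assoc, ← mul_pow]
    norm_num
    exact one_le_pow₀ (by norm_num)
  have h1 : ∀ A ∈ Finset.univ.filter (fun A : Finset (Fin n) =>
      ¬ (n ≤ 4 * A.card ∧ 4 * A.card ≤ 3 * n)), (1 : ℝ) ≤
        (27 / 64 : ℝ) ^ A.card * (4 / 3 : ℝ) ^ (n - A.card) +
        (4 / 3 : ℝ) ^ A.card * (27 / 64 : ℝ) ^ (n - A.card) := by
    intro A hA
    have hle : A.card ≤ n := by simpa using Finset.card_le_univ A
    have hA := (Finset.mem_filter.1 hA).2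
    rcases Nat.lt_or_ge (4 * A.card) n with h | h
    · have := hw A.card (n - A.card) (by omega) h.le
      have : (0 : ℝ) ≤ (4 / 3 : ℝ) ^ A.card * (27 / 64 : ℝ) ^ (n - A.card) := by positivity
      linarith
    · have := hw (n - A.card) A.card (by omega) (by omega)
      have : (0 : ℝ) ≤ (27 / 64 : ℝ) ^ A.card * (4 / 3 : ℝ) ^ (n - A.card) := by positivity
      linarith
  rw [Finset.card_eq_sum_ones]
  push_cast
  refine (Finset.sum_le_sum h1).trans ((Finset.sum_le_sum_of_subset_of_nonneg
    (Finset.filter_subset _ _) fun A _ _ => by positivity).trans ?_)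
  rw [Finset.sum_add_distrib]
  have e1 := Fintype.sum_pow_mul_eq_add_pow (Fin n) (27 / 64 : ℝ) (4 / 3)
  have e2 := Fintype.sum_pow_mul_eq_add_pow (Fin n) (4 / 3 : ℝ) (27 / 64)
  rw [Fintype.card_fin] at e1 e2
  rw [e1, e2]
  norm_num
  linarith

lemma two_pow_le_mul_choose_middle (n : ℕ) : (2 : ℝ) ^ n ≤ (n + 1) * n.choose (n / 2) := by
  have h : 2 ^ n ≤ (n + 1) * n.choose (n / 2) := by
    rw [← Nat.sum_range_choose, ← smul_eq_mul]
    refine (Finset.sum_le_card_nsmul _ _ _ fun r _ => Nat.choose_le_middle r n).trans_eq ?_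
    rw [Finset.card_range]
  exact_mod_cast h

lemma eventually_tail_le {τ : ℝ} (hτ : 0 < τ) :
    ∀ᶠ n : ℕ in Filter.atTop, 2 * (337 / 192 : ℝ) ^ n ≤ τ * n.choose (n / 2) := by
  have h1 : Filter.Tendsto (fun n : ℕ => 2 * ((n : ℝ) ^ 1 * (337 / 384 : ℝ) ^ n +
      (337 / 384 : ℝ) ^ n)) Filter.atTop (nhds (2 * (0 + 0))) :=
    ((tendsto_pow_const_mul_const_pow_of_abs_lt_one 1 (by norm_num [abs_lt])).add
      (tendsto_pow_atTop_nhds_zero_of_lt_one (by norm_num) (by norm_num))).const_mul 2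
  filter_upwards [h1.eventually (ge_mem_nhds (by simpa using hτ))] with n hn
  have h2 := two_pow_le_mul_choose_middle n
  have hn1 : (0 : ℝ) < n + 1 := by positivity
  have e : (337 / 192 : ℝ) ^ n = (337 / 384 : ℝ) ^ n * 2 ^ n := by rw [← mul_pow]; norm_num
  have hq : (0 : ℝ) ≤ (337 / 384 : ℝ) ^ n := by positivity
  calc 2 * (337 / 192 : ℝ) ^ n ≤ 2 * ((337 / 384 : ℝ) ^ n * ((n + 1) * n.choose (n / 2))) := by
        rw [e]; gcongr
    _ = (2 * ((n : ℝ) ^ 1 * (337 / 384 : ℝ) ^ n + (337 / 384 : ℝ) ^ n)) * n.choose (n / 2) := by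
        ring
    _ ≤ _ := by gcongr

end

/-! ### Asymptotic bounds -/

/-- If `m`-cycle-free graphs have asymptotic edge density at most `β < γ ^ 2`, then crown-free
families have asymptotically at most `1 / (1 - γ / 2)` times the size of the middle level. -/
lemma eventually_La_crown_le {m : ℕ} (hm : 3 ≤ m) {β K γ θ τ : ℝ} (hβ : 0 ≤ β) (hK : 0 ≤ K)
    (hcyc : CycleDensityBound m β K) (hγ : 0 ≤ γ) (hγβ : β < γ ^ 2) (hθ : γ / 2 < θ) (hθ1 : θ < 1)
    (hτ : 0 < τ) : ∀ᶠ n : ℕ in Filter.atTop,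
      (La n (Crown m) : ℝ) ≤ (1 / (1 - θ) + τ) * n.choose (n / 2) := by
  have l1 : Filter.Tendsto (fun n : ℕ => β + 4 * (β + K + 1) / (n : ℝ)) Filter.atTop
      (nhds (β + 0)) := (tendsto_const_div_atTop_nhds_zero_nat _).const_add β
  have l2 : Filter.Tendsto (fun n : ℕ => γ / 2 + 280 * (m / (n : ℝ))) Filter.atTop
      (nhds (γ / 2 + 280 * 0)) :=
    ((tendsto_const_div_atTop_nhds_zero_nat _).const_mul 280).const_add _
  filter_upwards [l1.eventually (ge_mem_nhds (by simpa using hγβ)),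
    l2.eventually (ge_mem_nhds (by simpa using hθ)), Filter.eventually_ge_atTop 16,
    eventually_tail_le hτ] with n h1 h2 h3 h4
  obtain ⟨F, hF, hcard⟩ := exists_posetFree_card_eq_La m n
  rw [← hcard]
  set M := F.filter (fun A => n ≤ 4 * A.card ∧ 4 * A.card ≤ 3 * n) with hM
  have hMF : M ⊆ F := Finset.filter_subset _ _
  have hMl := lubell_le_of_posetFree hm hβ hK hcyc hγ h1 (posetFree_mono hF hMF)
    (fun A hA => (Finset.mem_filter.1 hA).2) h3
  have hM0 := lubell_nonneg M
  have hMθ : lubell M ≤ 1 / (1 - θ) := by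
    rw [le_div_iff₀ (by linarith)]
    have := mul_le_mul_of_nonneg_right h2 hM0
    linarith
  have hsplit : (F.card : ℝ) = M.card +
      (F.filter (fun A => ¬ (n ≤ 4 * A.card ∧ 4 * A.card ≤ 3 * n))).card := by
    exact_mod_cast (Finset.card_filter_add_card_filter_not _).symm
  have ht : ((F.filter (fun A => ¬ (n ≤ 4 * A.card ∧ 4 * A.card ≤ 3 * n))).card : ℝ) ≤
      2 * (337 / 192 : ℝ) ^ n := by
    refine le_trans ?_ (card_filter_not_middle_le n)
    exact_mod_cast Finset.card_le_card (Finset.filter_subset_filter _ (Finset.subset_univ _))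
  have hc := (card_le_choose_mul_lubell M).trans
    (mul_le_mul_of_nonneg_left hMθ (Nat.cast_nonneg _))
  rw [hsplit, add_mul]
  linarith

lemma eventually_La_crown_even_le {k : ℕ} (hk : 2 ≤ k) {δ : ℝ} (hδ : 0 < δ) :
    ∀ᶠ n : ℕ in Filter.atTop, (La n (Crown (2 * k)) : ℝ) ≤ (1 + δ) * n.choose (n / 2) := by
  -- With `r = 1` the density β is just ε = θ²/2 < θ², so γ = θ is allowed; since θ ≤ 1/2, 1/(1 - θ)
  -- ≤ 1 + 2θ ≤ 1 + δ/2.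
  set θ : ℝ := min (1 / 2) (δ / 4) with hθ
  have hθ0 : 0 < θ := by positivity
  have hθ1 : θ ≤ 1 / 2 := min_le_left _ _
  have hθ2 : θ ≤ δ / 4 := min_le_right _ _
  obtain ⟨K, hK, hcyc⟩ := exists_card_adj_le (m := 2 * k) (r := 1) (ε := θ ^ 2 / 2)
    (by positivity) (by norm_num; positivity) (hasCycleIn_completeEquipartite_two (by omega))
  filter_upwards [eventually_La_crown_le (m := 2 * k) (by omega) (γ := θ) (θ := θ) (τ := δ / 2)
    (by norm_num; positivity) hK hcyc hθ0.le (by norm_num; nlinarith) (by linarith) (by linarith)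
    (by linarith)] with n hn
  refine hn.trans (mul_le_mul_of_nonneg_right ?_ (Nat.cast_nonneg _))
  have : 1 / (1 - θ) ≤ 1 + δ / 2 := by
    rw [div_le_iff₀ (by linarith)]
    nlinarith
  linarith

lemma eventually_La_crown_odd_le {m : ℕ} (hm : 3 ≤ m) :
    ∀ᶠ n : ℕ in Filter.atTop,
      (La n (Crown m) : ℝ) ≤ (1 + Real.sqrt 2 / 2) * n.choose (n / 2) := by
  obtain ⟨K, hK, hcyc⟩ := exists_card_adj_le (m := m) (r := 2) (ε := 1 / 100)
    (by positivity) (by norm_num) (hasCycleIn_completeEquipartite_three hm)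
  -- Here β = 0.51 < 9/16 = γ² and γ/2 = 3/8 < 2/5; the resulting 5/3 + 1/100 is below 1.7 ≤ 1 +
  -- √2/2.
  filter_upwards [eventually_La_crown_le hm (γ := 3 / 4) (θ := 2 / 5) (τ := 1 / 100)
    (by norm_num) hK hcyc (by norm_num) (by norm_num) (by norm_num) (by norm_num)
    (by norm_num)] with n hn
  refine hn.trans (mul_le_mul_of_nonneg_right ?_ (Nat.cast_nonneg _))
  have : (1.4 : ℝ) ≤ Real.sqrt 2 := Real.le_sqrt_of_sq_le (by norm_num)
  linarith

theorem theorem3 (k : ℕ) (hk : 2 ≤ k) :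
    (∃ ε : ℕ → ℝ, Filter.Tendsto ε Filter.atTop (nhds 0) ∧
      ∀ n : ℕ, (La n (Crown (2 * k)) : ℝ) = (1 + ε n) * (n.choose (n / 2) : ℝ)) ∧
    (∃ ε : ℕ → ℝ, Filter.Tendsto ε Filter.atTop (nhds 0) ∧
      ∀ n : ℕ, (La n (Crown (2 * k - 1)) : ℝ) ≤
        (1 + Real.sqrt 2 / 2 + ε n) * (n.choose (n / 2) : ℝ)) := by
  have hpos : ∀ n : ℕ, (0 : ℝ) < n.choose (n / 2) := fun n => by
    exact_mod_cast Nat.choose_pos (Nat.div_le_self n 2)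
  constructor
  · refine ⟨fun n => La n (Crown (2 * k)) / (n.choose (n / 2) : ℝ) - 1, ?_, fun n => ?_⟩
    · rw [Metric.tendsto_nhds]
      intro δ hδ
      filter_upwards [eventually_La_crown_even_le hk (half_pos hδ)] with n hn
      have h1 : (n.choose (n / 2) : ℝ) ≤ La n (Crown (2 * k)) := by
        exact_mod_cast choose_middle_le_La (2 * k) n
      rw [← div_le_iff₀ (hpos n)] at hn
      rw [← one_le_div (hpos n)] at h1
      rw [Real.dist_eq, sub_zero, abs_of_nonneg (by linarith)]
      linarith
    · have := (hpos n).ne'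
      field_simp
      ring
  -- The odd bound holds for large n with no error term, so this ε is eventually 0; the maximum only
  -- absorbs small n.
  · refine ⟨fun n => max 0 (La n (Crown (2 * k - 1)) / (n.choose (n / 2) : ℝ) -
      (1 + Real.sqrt 2 / 2)), ?_, fun n => ?_⟩
    · refine tendsto_const_nhds.congr' ?_
      filter_upwards [eventually_La_crown_odd_le (m := 2 * k - 1) (by omega)] with n hn
      rw [← div_le_iff₀ (hpos n)] at hn
      rw [max_eq_left (by linarith)]
    · rw [← div_le_iff₀ (hpos n)]
      have := le_max_right 0 (La n (Crown (2 * k - 1)) / (n.choose (n / 2) : ℝ) -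
        (1 + Real.sqrt 2 / 2))
      linarith
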